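/- Corollary 2.4, 2°. Let $n\ge 1$ and let $\Gamma\subset GL(n,\mathbb Z)$ be a subgroup such that the inclusion $\mathbb Z^n\subset\mathbb Z^n\rtimes\Gamma$ has the relative property (T): there are $\delta>0$ and a finite set $F\subset \mathbb Z^n\rtimes\Gamma$ such that every unitary representation $\pi$ of $\mathbb Z^n\rtimes\Gamma$ on a Hilbert space that has a unit vector $\xi$ with $\|\pi(g)\xi-\xi\|<\delta$ for all $g\in F$ has a non-zero $\mathbb Z^n$-invariant vector. Let $\Gamma$ act on $\mathbb Z^{2n}$ by $\theta(g)=\begin{pmatrix} g&0\\0&(g^{-1})^t\end{pmatrix}$, and let $\nu(x,y)=x^tJy$ for $x,y\in\mathbb Z^{2n}$, where $J=\begin{pmatrix}0&I_n\\-I_n&0\end{pmatrix}$. For each $\alpha\in\mathbb T$ fix a square root $\alpha^{1/2}\in\mathbb T$, and let $\nu_\alpha$ be the 2-cocycle $$\nu_\alpha\big((x_1,\gamma_1),(x_2,\gamma_2)\big)=(\alpha^{1/2})^{\nu(x_1,\theta(\gamma_1)x_2)}$$ on $G=\mathbb Z^{2n}\rtimes_\theta\Gamma$. Let $M_\alpha=L_{\nu_\alpha}(G)=\lambda_{\nu_\alpha}(G)''$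 be the von Neumann algebra on $\ell^2(G)$ generated by the unitaries $\lambda_{\nu_\alpha}(g)$, where $\lambda_{\nu_\alpha}(g)\xi_h=\nu_\alpha(g,h)\xi_{gh}$ on the canonical basis $(\xi_h)_{h\in G}$. Then, for every choice of the square roots: (i) $M_\alpha$ is a $\mathrm{II}_1$ factor for every $\alpha\in\mathbb T$ that is not a root of unity. (ii) There is no $\mathrm{II}_1$ factor $M$ on a separable Hilbert space such that every factor $M_\alpha$, $\alpha\in\mathbb T$ not a root of unity, embeds into $M$ (by an injective $*$-homomorphism, not necessarily unital). In particular the $M_\alpha$, $\alpha\in\mathbb T$, cannot all be embedded into one separable $\mathrm{II}_1$ factor. (iii) The $M_\alpha$ are non stably isomorphic modulo countable sets: for every $\alpha_0\in\mathbb T$ there are at most countably many $\alpha\in\mathbb T$ such that $M_\alpha$ is isomorphic to $p\,M_k(M_{\alpha_0})\,p$ for some $k\in\mathbb N$ and some projection $p\in M_k(M_{\alpha_0})$. -/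

import Mathlib

universe u v

/-! ### Relative property (T) for an inclusion of discrete groups -/

/-- The inclusion `H ⊆ G` of discrete groups has the relative property (T) of Kazhdan-Margulis:
there are `δ > 0` and a finite `F ⊆ G` such that every unitary representation of `G` on a Hilbert
space having a unit vector which is moved by less than `δ` by all elements of `F` has a nonzero
`H`-invariant vector. (For `G : Type u` every cyclic representation of `G` lives on a Hilbert space
that is isomorphic to one in `Type u`, so nothing is lost by taking `K : Type u`.) -/
def HasRelativePropertyT {G : Type u} [Group G] (H : Subgroup G) : Prop :=
  ∃ δ : ℝ, 0 < δ ∧ ∃ F : Finset G,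
    ∀ (K : Type u) [NormedAddCommGroup K] [InnerProductSpace ℂ K] [CompleteSpace K]
      (π : G →* unitary (K →L[ℂ] K)) (ξ : K), ‖ξ‖ = 1 →
      (∀ g ∈ F, ‖(π g : K →L[ℂ] K) ξ - ξ‖ < δ) →
      ∃ ξ₀ : K, ξ₀ ≠ 0 ∧ ∀ h ∈ H, (π h : K →L[ℂ] K) ξ₀ = ξ₀

/-! ### Von Neumann algebras -/

section VonNeumann

variable {H : Type u} [NormedAddCommGroup H] [InnerProductSpace ℂ H] [CompleteSpace H]
  {K : Type v} [NormedAddCommGroup K] [InnerProductSpace ℂ K] [CompleteSpace K]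

/-- The von Neumann algebra `(S ∪ S*)''` generated by a set `S` of bounded operators. -/
noncomputable def vonNeumannGenerated (S : Set (H →L[ℂ] H)) : VonNeumannAlgebra H where
  toStarSubalgebra := StarSubalgebra.centralizer ℂ (StarSubalgebra.centralizer ℂ S : Set (H →L[ℂ] H))
  centralizer_centralizer' := by
    change Set.centralizer (Set.centralizer (StarSubalgebra.centralizer ℂ
      (StarSubalgebra.centralizer ℂ S : Set (H →L[ℂ] H)) : Set (H →L[ℂ] H))) =
      (StarSubalgebra.centralizer ℂ
      (StarSubalgebra.centralizer ℂ S : Set (H →L[ℂ] H)) : Set (H →L[ℂ] H))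
    rw [StarSubalgebra.coe_centralizer_centralizer, Set.centralizer_centralizer_centralizer]

/-- `τ` is a faithful normal tracial state on `M`. Normality of a positive functional means that
it is a countable sum `x ↦ ∑ i, ⟪ξ i, x (ξ i)⟫` of vector functionals with `∑ i, ‖ξ i‖ ^ 2 < ∞`;
positivity is part of this. -/
structure IsFaithfulNormalTrace (M : VonNeumannAlgebra H) (τ : M.toStarSubalgebra →ₗ[ℂ] ℂ) :
    Prop where
  map_one : τ 1 = 1
  tracial : ∀ x y, τ (x * y) = τ (y * x)
  faithful : ∀ x, τ (star x * x) = 0 → x = 0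
  normal : ∃ ξ : ℕ → H, Summable (fun i => ‖ξ i‖ ^ 2) ∧
    ∀ x : M.toStarSubalgebra, HasSum (fun i => inner ℂ (ξ i) ((x : H →L[ℂ] H) (ξ i))) (τ x)

/-- A `II₁` factor: an infinite-dimensional von Neumann algebra with trivial centre that has a
faithful normal tracial state. -/
structure IsII1Factor (M : VonNeumannAlgebra H) : Prop where
  trivial_center : ∀ x : M.toStarSubalgebra, (∀ y, x * y = y * x) → ∃ c : ℂ, x = c • 1
  infinite_dimensional : ¬ FiniteDimensional ℂ M.toStarSubalgebra
  exists_trace : ∃ τ : M.toStarSubalgebra →ₗ[ℂ] ℂ, IsFaithfulNormalTrace M τ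

/-- `M` embeds into `N`, not necessarily unitally. (An injective *-homomorphism from a `II₁` factor
to a `II₁` factor is automatically normal.) -/
def EmbedsInto (M : VonNeumannAlgebra H) (N : VonNeumannAlgebra K) : Prop :=
  ∃ φ : M.toStarSubalgebra →⋆ₙₐ[ℂ] N.toStarSubalgebra, Function.Injective φ

/-- `M` is isomorphic to an amplification `p M_k(N) p` of `N`, for a `k` and a projection
`p ∈ M_k(N)`: there is an injective *-homomorphism of `M` into `M_k(N)` with range the corner
`p M_k(N) p = {x | p x p = x}`. -/
def StablyIsomorphic (M : VonNeumannAlgebra H) (N : VonNeumannAlgebra K) : Prop :=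
  ∃ (k : ℕ) (p : Matrix (Fin k) (Fin k) N.toStarSubalgebra), IsStarProjection p ∧
    ∃ φ : M.toStarSubalgebra →⋆ₙₐ[ℂ] Matrix (Fin k) (Fin k) N.toStarSubalgebra,
      Function.Injective φ ∧ Set.range φ = {x | p * x * p = x}

end VonNeumann

/-! ### Cocycle group von Neumann algebras -/

section Twisted

theorem memℓp_twist {X : Type u} (a : X → Circle) (e : X ≃ X) (f : lp (fun _ : X => ℂ) 2) :
    Memℓp (fun k => (a k : ℂ) * f (e k)) 2 := by
  have h2 : (0 : ℝ) < (2 : ENNReal).toReal := by norm_num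
  rw [memℓp_gen_iff h2]
  have h := (memℓp_gen_iff h2).1 (lp.memℓp f)
  refine ((e.summable_iff (f := fun k => ‖f k‖ ^ (2 : ENNReal).toReal)).2 h).congr fun k => ?_
  change _ = ‖(a k : ℂ) * f (e k)‖ ^ (2 : ENNReal).toReal
  rw [norm_mul, Circle.norm_coe, one_mul, Function.comp_apply]

variable {G : Type u} [Group G]

/-- A scalar 2-cocycle on `G`. -/
def IsScalarTwoCocycle (μ : G → G → Circle) : Prop :=
  ∀ g h k, μ g h * μ (g * h) k = μ h k * μ g (h * k)

/-- The unitary `λ_μ(g)` of `ℓ²(G)`, which maps the basis vector `ξ_h` to `μ(g, h) ξ_{gh}`. -/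
noncomputable def twistedLeftRegular (μ : G → G → Circle) (g : G) :
    lp (fun _ : G => ℂ) 2 ≃ₗᵢ[ℂ] lp (fun _ : G => ℂ) 2 where
  toFun f := ⟨fun k => (μ g (g⁻¹ * k) : ℂ) * f (g⁻¹ * k),
    memℓp_twist (fun k => μ g (g⁻¹ * k)) (Equiv.mulLeft g⁻¹) f⟩
  invFun f := ⟨fun h => ((μ g h)⁻¹ : Circle) * f (g * h),
    memℓp_twist (fun h => (μ g h)⁻¹) (Equiv.mulLeft g) f⟩
  map_add' f f' := by
    ext k
    exact mul_add _ _ _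
  map_smul' c f := by
    ext k
    simp [mul_left_comm]
  left_inv f := by
    ext k
    simp
  right_inv f := by
    ext k
    simp
  norm_map' f := by
    have h2 : (0 : ℝ) < (2 : ENNReal).toReal := by norm_num
    rw [lp.norm_eq_tsum_rpow h2, lp.norm_eq_tsum_rpow h2]
    rw [← (Equiv.mulLeft g⁻¹).tsum_eq (fun k => ‖f k‖ ^ (2 : ENNReal).toReal)]
    congr 1
    refine tsum_congr fun k => ?_
    change ‖(μ g (g⁻¹ * k) : ℂ) * f (g⁻¹ * k)‖ ^ (2 : ENNReal).toReal = _
    rw [norm_mul, Circle.norm_coe, one_mul, Equiv.coe_mulLeft]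

/-- The cocycle group von Neumann algebra `L_μ(G) = λ_μ(G)''`. -/
noncomputable def twistedGroupVN (μ : G → G → Circle) :
    VonNeumannAlgebra (lp (fun _ : G => ℂ) 2) :=
  vonNeumannGenerated (Set.range fun g =>
    (twistedLeftRegular μ g : lp (fun _ : G => ℂ) 2 →L[ℂ] lp (fun _ : G => ℂ) 2))

/-- `L_μ(G)` is the double commutant of `λ_μ(G)`; since the `λ_μ(g)` are unitary, closing up under
adjoints first makes no difference. -/
theorem coe_twistedGroupVN (μ : G → G → Circle) :
    (twistedGroupVN μ : Set (lp (fun _ : G => ℂ) 2 →L[ℂ] lp (fun _ : G => ℂ) 2)) =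
      Set.centralizer (Set.centralizer (Set.range fun g =>
        (twistedLeftRegular μ g : lp (fun _ : G => ℂ) 2 →L[ℂ] lp (fun _ : G => ℂ) 2))) := by
  set S := Set.range fun g =>
    (twistedLeftRegular μ g : lp (fun _ : G => ℂ) 2 →L[ℂ] lp (fun _ : G => ℂ) 2) with hS
  have h1 : (twistedGroupVN μ : Set (lp (fun _ : G => ℂ) 2 →L[ℂ] lp (fun _ : G => ℂ) 2)) =
      (S ∪ star S).centralizer.centralizer := StarSubalgebra.coe_centralizer_centralizer ℂ S
  rw [h1]
  congr 1
  refine Set.Subset.antisymm (Set.centralizer_subset Set.subset_union_left) ?_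
  rintro T hT A (hA | hA)
  · exact hT A hA
  · obtain ⟨g, hg⟩ := hA
    have hT' := hT (star A) ⟨g, hg⟩
    have hu : star A ∈ unitary (lp (fun _ : G => ℂ) 2 →L[ℂ] lp (fun _ : G => ℂ) 2) := by
      rw [← hg]
      exact (Unitary.linearIsometryEquiv.symm (twistedLeftRegular μ g)).2
    have e1 : A * star A = 1 := by simpa using (Unitary.mem_iff.1 hu).1
    have e2 : star A * A = 1 := by simpa using (Unitary.mem_iff.1 hu).2
    calc A * T = A * T * (star A * A) := by rw [e2, mul_one]
      _ = A * (T * star A) * A := by simp only [mul_assoc]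
      _ = A * (star A * T) * A := by rw [hT']
      _ = (A * star A) * T * A := by simp only [mul_assoc]
      _ = T * A := by rw [e1, one_mul]

/-- `λ_μ(g) ξ_h = μ(g, h) ξ_{gh}`. -/
theorem twistedLeftRegular_single [DecidableEq G] (μ : G → G → Circle) (g h : G) :
    twistedLeftRegular μ g (lp.single 2 h (1 : ℂ)) =
      (μ g h : ℂ) • lp.single 2 (g * h) (1 : ℂ) := by
  ext k
  change (μ g (g⁻¹ * k) : ℂ) * (lp.single 2 h (1 : ℂ) : lp (fun _ : G => ℂ) 2) (g⁻¹ * k) =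
    (μ g h : ℂ) * (lp.single 2 (g * h) (1 : ℂ) : lp (fun _ : G => ℂ) 2) k
  by_cases hk : k = g * h
  · subst hk
    simp
  · have hk' : g⁻¹ * k ≠ h := fun e => hk (by rw [← e, mul_inv_cancel_left])
    simp [lp.single_apply, hk, hk']

end Twisted

/-! ### The groups `ℤ^m ⋊ Γ` and the cocycles `ν_α` -/

section Lattice

open Matrix

/-- The action of `GL(ι, ℤ)` on (column vectors of) `ℤ^ι`, written multiplicatively. -/
def matrixAction (ι : Type) [Fintype ι] [DecidableEq ι] :
    GeneralLinearGroup ι ℤ →* MulAut (Multiplicative (ι → ℤ)) where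
  toFun A :=
    { toFun := fun x => Multiplicative.ofAdd ((A : Matrix ι ι ℤ) *ᵥ x.toAdd)
      invFun := fun x => Multiplicative.ofAdd (((A⁻¹ : GeneralLinearGroup ι ℤ) : Matrix ι ι ℤ) *ᵥ
        x.toAdd)
      left_inv := fun x => by
        beta_reduce
        rw [toAdd_ofAdd, mulVec_mulVec, ← Units.val_mul, inv_mul_cancel, Units.val_one, one_mulVec,
          ofAdd_toAdd]
      right_inv := fun x => by
        beta_reduce
        rw [toAdd_ofAdd, mulVec_mulVec, ← Units.val_mul, mul_inv_cancel, Units.val_one, one_mulVec,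
          ofAdd_toAdd]
      map_mul' := fun x y => by rw [toAdd_mul, mulVec_add, ofAdd_add] }
  map_one' := by
    ext x
    simp
  map_mul' A B := by
    ext x
    simp [mulVec_mulVec]

/-- The semidirect product `ℤ^ι ⋊_ρ Γ`, where `Γ` acts through `ρ : Γ → GL(ι, ℤ)`. -/
abbrev LatticeSemidirect {Γ : Type} [Group Γ] {ι : Type} [Fintype ι] [DecidableEq ι]
    (ρ : Γ →* GeneralLinearGroup ι ℤ) : Type :=
  Multiplicative (ι → ℤ) ⋊[(matrixAction ι).comp ρ] Γ

/-- The subgroup `ℤ^ι` of `ℤ^ι ⋊_ρ Γ`. -/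
def latticeSubgroup {Γ : Type} [Group Γ] {ι : Type} [Fintype ι] [DecidableEq ι]
    (ρ : Γ →* GeneralLinearGroup ι ℤ) : Subgroup (LatticeSemidirect ρ) :=
  (SemidirectProduct.inl : Multiplicative (ι → ℤ) →* LatticeSemidirect ρ).range

/-- The homomorphism `θ(g) = diag(g, (g⁻¹)ᵗ)` from `GL(n, ℤ)` to `GL(2n, ℤ)`. -/
def doubling (n : ℕ) :
    GeneralLinearGroup (Fin n) ℤ →* GeneralLinearGroup (Fin n ⊕ Fin n) ℤ where
  toFun g :=
    { val := fromBlocks (g : Matrix (Fin n) (Fin n) ℤ) 0 0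
        ((g⁻¹ : GeneralLinearGroup (Fin n) ℤ) : Matrix (Fin n) (Fin n) ℤ)ᵀ
      inv := fromBlocks ((g⁻¹ : GeneralLinearGroup (Fin n) ℤ) : Matrix (Fin n) (Fin n) ℤ) 0 0
        (g : Matrix (Fin n) (Fin n) ℤ)ᵀ
      val_inv := by
        rw [fromBlocks_multiply, ← transpose_mul, ← Units.val_mul, mul_inv_cancel]
        simp
      inv_val := by
        rw [fromBlocks_multiply, ← transpose_mul, ← Units.val_mul, inv_mul_cancel]
        simp }
  map_one' := by
    ext1
    simp
  map_mul' g h := by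
    ext1
    simp [fromBlocks_multiply, ← transpose_mul, -coe_units_inv]

/-- The integer valued cocycle `ν(x, y) = xᵗ J y` on `ℤ^{2n}`, with `J = (0, 1; -1, 0)`. -/
def symplecticForm {n : ℕ} (x y : Fin n ⊕ Fin n → ℤ) : ℤ :=
  x ⬝ᵥ (fromBlocks 0 1 (-1) 0 : Matrix (Fin n ⊕ Fin n) (Fin n ⊕ Fin n) ℤ) *ᵥ y

/-- The group `ℤ^{2n} ⋊_θ Γ` for a subgroup `Γ` of `GL(n, ℤ)`. -/
abbrev DoubledGroup {n : ℕ} (Γ : Subgroup (GeneralLinearGroup (Fin n) ℤ)) : Type :=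
  LatticeSemidirect ((doubling n).comp Γ.subtype)

/-- The 2-cocycle `((x₁, γ₁), (x₂, γ₂)) ↦ β ^ ν(x₁, θ(γ₁) x₂)` on `ℤ^{2n} ⋊_θ Γ`; for `β = α^{1/2}`
this is `ν_α = α^{ν/2}`. -/
noncomputable def symplecticCocycle {n : ℕ} (Γ : Subgroup (GeneralLinearGroup (Fin n) ℤ)) (β : Circle)
    (g h : DoubledGroup Γ) : Circle :=
  β ^ symplecticForm g.left.toAdd
    ((doubling n g.right : Matrix (Fin n ⊕ Fin n) (Fin n ⊕ Fin n) ℤ) *ᵥ h.left.toAdd)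

/-- `ν` is invariant under `θ(GL(n, ℤ))`. -/
theorem symplecticForm_doubling {n : ℕ} (g : GeneralLinearGroup (Fin n) ℤ)
    (x y : Fin n ⊕ Fin n → ℤ) :
    symplecticForm ((doubling n g : Matrix (Fin n ⊕ Fin n) (Fin n ⊕ Fin n) ℤ) *ᵥ x)
      ((doubling n g : Matrix (Fin n ⊕ Fin n) (Fin n ⊕ Fin n) ℤ) *ᵥ y) = symplecticForm x y := by
  have h1 : ((g : Matrix (Fin n) (Fin n) ℤ))ᵀ *
      ((g⁻¹ : GeneralLinearGroup (Fin n) ℤ) : Matrix (Fin n) (Fin n) ℤ)ᵀ = 1 := by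
    rw [← transpose_mul, ← Units.val_mul, inv_mul_cancel, Units.val_one, transpose_one]
  have h2 : ((g⁻¹ : GeneralLinearGroup (Fin n) ℤ) : Matrix (Fin n) (Fin n) ℤ) *
      (g : Matrix (Fin n) (Fin n) ℤ) = 1 := by
    rw [← Units.val_mul, inv_mul_cancel, Units.val_one]
  have key : (doubling n g : Matrix (Fin n ⊕ Fin n) (Fin n ⊕ Fin n) ℤ)ᵀ *
      (fromBlocks 0 1 (-1) 0 : Matrix (Fin n ⊕ Fin n) (Fin n ⊕ Fin n) ℤ) *
      (doubling n g : Matrix (Fin n ⊕ Fin n) (Fin n ⊕ Fin n) ℤ) = fromBlocks 0 1 (-1) 0 := by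
    simp [doubling, fromBlocks_transpose, fromBlocks_multiply, h1, h2, -coe_units_inv]
  unfold symplecticForm
  rw [← vecMul_transpose, ← dotProduct_mulVec, mulVec_mulVec, mulVec_mulVec, key]

theorem isScalarTwoCocycle_symplecticCocycle {n : ℕ}
    (Γ : Subgroup (GeneralLinearGroup (Fin n) ℤ)) (β : Circle) :
    IsScalarTwoCocycle (symplecticCocycle Γ β) := by
  intro g h k
  have hadd : ∀ x y z : Fin n ⊕ Fin n → ℤ,
      symplecticForm (x + y) z = symplecticForm x z + symplecticForm y z := by
    intro x y z
    simp [symplecticForm, add_dotProduct]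
  have hadd' : ∀ x y z : Fin n ⊕ Fin n → ℤ,
      symplecticForm x (y + z) = symplecticForm x y + symplecticForm x z := by
    intro x y z
    simp [symplecticForm, mulVec_add, dotProduct_add]
  have hl : ∀ a b : DoubledGroup Γ, (a * b).left.toAdd = a.left.toAdd +
      (doubling n a.right : Matrix (Fin n ⊕ Fin n) (Fin n ⊕ Fin n) ℤ) *ᵥ b.left.toAdd :=
    fun a b => rfl
  have hr : (doubling n ((g * h).right : Γ) : Matrix (Fin n ⊕ Fin n) (Fin n ⊕ Fin n) ℤ) =
      (doubling n g.right : Matrix (Fin n ⊕ Fin n) (Fin n ⊕ Fin n) ℤ) *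
      (doubling n h.right : Matrix (Fin n ⊕ Fin n) (Fin n ⊕ Fin n) ℤ) := by
    rw [SemidirectProduct.mul_right, Subgroup.coe_mul, map_mul, Units.val_mul]
  unfold symplecticCocycle
  rw [← _root_.zpow_add, ← _root_.zpow_add, hl, hl, hr, hadd, mulVec_add, hadd', ← mulVec_mulVec,
    symplecticForm_doubling]
  congr 1
  ring

/-- `M_α(Γ, n) = L_{ν_α}(ℤ^{2n} ⋊_θ Γ)`, where `β = α^{1/2}`. -/
noncomputable def doubledTwistedVN {n : ℕ} (Γ : Subgroup (GeneralLinearGroup (Fin n) ℤ))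
    (β : Circle) : VonNeumannAlgebra (lp (fun _ : DoubledGroup Γ => ℂ) 2) :=
  twistedGroupVN (symplecticCocycle Γ β)

end Lattice

open scoped InnerProductSpace

/-! The non-embedding statements come from a separability argument against rigidity. The first
summand of ℤ²ⁿ is isotropic for ν, so λ restricts to a genuine representation U_α of ℤⁿ ⋊ Γ inside
M_α, while a translation P_α from the second summand satisfies U_α(t_k) P_α = α^k P_α U_α(t_k) for
suitable t_k in ℤⁿ. Suppose that uncountably many M_α embed into an algebra with a faithful trace
and separable L² space. Then for some α ≠ β the images of U_α and U_β are close in trace norm at 1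
and on a finite set F, and P_α is close to P_β. The vector x = U_α(1) U_β(1)⋆ is almost invariant
under y ↦ U_α(g) y U_β(g)⋆ for g in F, so by relative property (T) it is almost invariant under all
of ℤⁿ, uniformly. Comparing with y ↦ P_α y P_β⋆ shows that (α β⁻¹)^k x stays close to x for every k.
The circle has no small subgroups, so α = β (`IsTracialMap.norm_pow_sub_one_mul_le`,
`IsTracialMap.countable_of_rigid`).

The same count applies to M_k(M_{α₀}), which settles stable isomorphism. Factoriality is a
computation with Fourier coefficients: those of a central element vanish off ℤ²ⁿ because conjugacy
classes there are infinite, and on ℤ²ⁿ away from 0 because ν is nondegenerate and α is not a root of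
unity. -/

/-! ### Relative property (T): from invariant vectors to uniform estimates -/

/-- A representation by norm preserving operators is a unitary representation. -/
noncomputable def unitaryRepOfNormEq {G : Type u} [Group G] {K : Type v} [NormedAddCommGroup K]
    [InnerProductSpace ℂ K] [CompleteSpace K] (ρ : G →* (K →L[ℂ] K))
    (h : ∀ g x, ‖ρ g x‖ = ‖x‖) : G →* unitary (K →L[ℂ] K) where
  toFun g := ⟨ρ g, by
    have h1 : star (ρ g) * ρ g = 1 :=
      (ContinuousLinearMap.norm_map_iff_adjoint_comp_self (ρ g)).1 (h g)
    have h2 : ρ g * ρ g⁻¹ = 1 := by rw [← map_mul, mul_inv_cancel, map_one]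
    have h3 : star (ρ g) = ρ g⁻¹ := by
      rw [← mul_one (star (ρ g)), ← h2, ← mul_assoc, h1, one_mul]
    exact Unitary.mem_iff.2 ⟨h1, by rw [h3, h2]⟩⟩
  map_one' := Subtype.ext (map_one ρ)
  map_mul' g k := Subtype.ext (map_mul ρ g k)

theorem unitaryRep_mul_apply {G : Type u} [Group G] {K : Type v} [NormedAddCommGroup K]
    [InnerProductSpace ℂ K] [CompleteSpace K] (π : G →* unitary (K →L[ℂ] K)) (g k : G) (x : K) :
    (π (g * k) : K →L[ℂ] K) x = (π g : K →L[ℂ] K) ((π k : K →L[ℂ] K) x) := by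
  rw [map_mul]
  rfl

theorem norm_unitary_apply {K : Type v} [NormedAddCommGroup K]
    [InnerProductSpace ℂ K] [CompleteSpace K] (u : unitary (K →L[ℂ] K)) (x : K) :
    ‖(u : K →L[ℂ] K) x‖ = ‖x‖ :=
  (Unitary.linearIsometryEquiv u).norm_map x

/-- The subspace of vectors fixed by the subgroup `H`. -/
def fixedSubmodule {G : Type u} [Group G] {K : Type v} [NormedAddCommGroup K]
    [InnerProductSpace ℂ K] [CompleteSpace K] (π : G →* unitary (K →L[ℂ] K)) (H : Subgroup G) :
    Submodule ℂ K where
  carrier := {x | ∀ h ∈ H, (π h : K →L[ℂ] K) x = x}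
  add_mem' {x y} hx hy h hh := by rw [map_add, hx h hh, hy h hh]
  zero_mem' h _ := map_zero _
  smul_mem' c x hx h hh := by rw [map_smul, hx h hh]

theorem inner_unitary_rep {G : Type u} [Group G] {K : Type v} [NormedAddCommGroup K]
    [InnerProductSpace ℂ K] [CompleteSpace K] (π : G →* unitary (K →L[ℂ] K)) (g : G) (x y : K) :
    inner ℂ x ((π g : K →L[ℂ] K) y) = inner ℂ ((π g⁻¹ : K →L[ℂ] K) x) y := by
  have h : (π g : K →L[ℂ] K) ((π g⁻¹ : K →L[ℂ] K) x) = x := by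
    rw [← unitaryRep_mul_apply, mul_inv_cancel, map_one]
    rfl
  conv_lhs => rw [← h]
  exact (Unitary.linearIsometryEquiv (π g)).inner_map_map _ _

/-- Normality enters here, through h g = g (g⁻¹ h g). -/
theorem fixedSubmodule_map_mem {G : Type u} [Group G] {K : Type v} [NormedAddCommGroup K]
    [InnerProductSpace ℂ K] [CompleteSpace K] (π : G →* unitary (K →L[ℂ] K)) (H : Subgroup G)
    [hH : H.Normal] (g : G) {x : K} (hx : x ∈ fixedSubmodule π H) :
    (π g : K →L[ℂ] K) x ∈ fixedSubmodule π H := by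
  intro h hh
  have h1 := hx (g⁻¹ * h * g) (by simpa using hH.conj_mem h hh g⁻¹)
  rw [← unitaryRep_mul_apply]
  conv_rhs => rw [← h1]
  rw [← unitaryRep_mul_apply]
  congr 3
  group

theorem fixedSubmodule_orthogonal_map_mem {G : Type u} [Group G] {K : Type v}
    [NormedAddCommGroup K] [InnerProductSpace ℂ K] [CompleteSpace K]
    (π : G →* unitary (K →L[ℂ] K)) (H : Subgroup G) [H.Normal] (g : G) {x : K}
    (hx : x ∈ (fixedSubmodule π H)ᗮ) : (π g : K →L[ℂ] K) x ∈ (fixedSubmodule π H)ᗮ := by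
  intro y hy
  rw [inner_unitary_rep]
  exact hx _ (fixedSubmodule_map_mem π H g⁻¹ hy)

/-- Relative property (T) for a normal subgroup: vectors that are almost invariant under a
suitable finite set are uniformly almost invariant under the subgroup. -/
theorem HasRelativePropertyT.exists_uniform_bound {G : Type u} [Group G] {H : Subgroup G}
    [H.Normal] (hT : HasRelativePropertyT H) :
    ∃ C : ℝ, 0 ≤ C ∧ ∃ F : Finset G, ∀ (K : Type u) [NormedAddCommGroup K]
      [InnerProductSpace ℂ K] [CompleteSpace K] (π : G →* unitary (K →L[ℂ] K)) (ξ : K) (κ : ℝ),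
      0 ≤ κ → (∀ g ∈ F, ‖(π g : K →L[ℂ] K) ξ - ξ‖ ≤ κ) →
      ∀ h ∈ H, ‖(π h : K →L[ℂ] K) ξ - ξ‖ ≤ C * κ := by
  obtain ⟨δ, hδ, F, hF⟩ := hT
  -- Let η be the component of ξ orthogonal to the `H`-fixed vectors. The complement contains no
  -- nonzero fixed vector, so property (T) forces δ‖η‖ ≤ κ. An element of `H` moves ξ exactly as it
  -- moves η, hence by at most 2‖η‖.
  refine ⟨2 / δ, by positivity, F, fun K _ _ _ π ξ κ hκ hξ h hh => ?_⟩
  set K₀ := fixedSubmodule π H with hK₀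
  let ρ : G →* (K₀ᗮ →L[ℂ] K₀ᗮ) :=
    { toFun := fun g => ((π g : K →L[ℂ] K) ∘L K₀ᗮ.subtypeL).codRestrict K₀ᗮ
        fun x => fixedSubmodule_orthogonal_map_mem π H g x.2
      map_one' := by
        ext x
        simp
      map_mul' := fun g k => by
        ext x
        exact unitaryRep_mul_apply π g k x }
  have hρ : ∀ g (x : K₀ᗮ), ((ρ g x : K₀ᗮ) : K) = (π g : K →L[ℂ] K) x := fun g x => rfl
  let π' := unitaryRepOfNormEq ρ fun g x => norm_unitary_apply (π g) x
  have hπ' : ∀ g (x : K₀ᗮ), (((π' g : K₀ᗮ →L[ℂ] K₀ᗮ) x : K₀ᗮ) : K) = (π g : K →L[ℂ] K) x :=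
    fun g x => rfl
  let η : K₀ᗮ := K₀ᗮ.orthogonalProjectionOnto ξ
  have hζ : ξ - η ∈ K₀ := by
    have h1 : IsClosed (K₀ : Set K) := by
      have : (K₀ : Set K) = ⋂ h ∈ H, {x | (π h : K →L[ℂ] K) x = x} := by
        ext x
        simp [hK₀, fixedSubmodule]
      rw [this]
      exact isClosed_biInter fun h _ =>
        isClosed_eq (π h : K →L[ℂ] K).continuous continuous_id
    have : CompleteSpace K₀ := h1.completeSpace_coe
    have h2 : ξ - η ∈ K₀ᗮᗮ := K₀ᗮ.sub_starProjection_mem_orthogonal ξ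
    rwa [Submodule.orthogonal_orthogonal] at h2
  -- Pythagoras: the displacements of the two components of ξ lie in orthogonal invariant subspaces.
  have hη : ∀ g, ‖(π g : K →L[ℂ] K) η - η‖ ≤ ‖(π g : K →L[ℂ] K) ξ - ξ‖ := by
    intro g
    have hz : (π g : K →L[ℂ] K) (ξ - η) - (ξ - η) ∈ K₀ :=
      K₀.sub_mem (fixedSubmodule_map_mem π H g hζ) hζ
    have he : (π g : K →L[ℂ] K) η - η ∈ K₀ᗮ :=
      K₀ᗮ.sub_mem (fixedSubmodule_orthogonal_map_mem π H g η.2) η.2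
    have hsum : (π g : K →L[ℂ] K) ξ - ξ =
        ((π g : K →L[ℂ] K) (ξ - η) - (ξ - η)) + ((π g : K →L[ℂ] K) η - η) := by
      rw [map_sub]
      abel
    have := norm_add_sq_eq_norm_sq_add_norm_sq_of_inner_eq_zero _ _ (he _ hz)
    rw [← hsum] at this
    nlinarith [norm_nonneg ((π g : K →L[ℂ] K) ξ - ξ), norm_nonneg ((π g : K →L[ℂ] K) η - η),
      mul_self_nonneg ‖(π g : K →L[ℂ] K) (ξ - η) - (ξ - η)‖]
  have hηδ : δ * ‖(η : K)‖ ≤ κ := by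
    by_cases h0 : η = 0
    · simpa [h0] using hκ
    · have hpos : 0 < ‖η‖ := norm_pos_iff.2 h0
      by_contra! hlt
      obtain ⟨x, hx0, hx⟩ := hF K₀ᗮ π' (((‖η‖ : ℂ))⁻¹ • η) (by
          rw [norm_smul, norm_inv, Complex.norm_real, norm_norm, inv_mul_cancel₀ hpos.ne']) (by
        intro g hg
        rw [map_smul, ← smul_sub, norm_smul, norm_inv, Complex.norm_real, norm_norm,
          inv_mul_lt_iff₀ hpos, mul_comm]
        calc ‖(π' g : K₀ᗮ →L[ℂ] K₀ᗮ) η - η‖ = ‖(π g : K →L[ℂ] K) η - η‖ := rfl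
          _ ≤ κ := (hη g).trans (hξ g hg)
          _ < _ := hlt)
      have hxK : (x : K) ∈ K₀ := fun h hh => by rw [← hπ', hx h hh]
      have := x.2 _ hxK
      rw [inner_self_eq_zero] at this
      exact hx0 (Subtype.ext this)
  have hfix : (π h : K →L[ℂ] K) ξ - ξ = (π h : K →L[ℂ] K) η - η := by
    have := hζ h hh
    rw [map_sub] at this
    rw [sub_eq_sub_iff_sub_eq_sub, this]
  rw [hfix, div_mul_eq_mul_div, le_div_iff₀ hδ]
  have := norm_sub_le ((π h : K →L[ℂ] K) η) η
  rw [norm_unitary_apply] at this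
  nlinarith

/-! ### Orbits in arbitrary inner product spaces -/

section OrbitMap

variable {G : Type u} {V : Type v} [NormedAddCommGroup V] [InnerProductSpace ℂ V]

/-- The inner product on `G →₀ ℂ` that is pulled back along `δ_g ↦ v g`. -/
noncomputable abbrev pulledBackCore (v : G → V) : PreInnerProductSpace.Core ℂ (G →₀ ℂ) where
  inner a b := inner ℂ (Finsupp.linearCombination ℂ v a) (Finsupp.linearCombination ℂ v b)
  conj_inner_symm _ _ := inner_conj_symm _ _
  re_inner_nonneg _ := inner_self_nonneg
  add_left _ _ _ := by rw [map_add, inner_add_left]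
  smul_left _ _ _ := by rw [map_smul, inner_smul_left]

/-- Norms of combinations depend only on the Gram matrix of the orbit, which left translation
preserves. -/
theorem norm_linearCombination_mapDomain [Group G] (v : G → V)
    (hv : ∀ k g h, inner ℂ (v (k * g)) (v (k * h)) = inner ℂ (v g) (v h)) (k : G) (a : G →₀ ℂ) :
    ‖Finsupp.linearCombination ℂ v (Finsupp.mapDomain (k * ·) a)‖ =
      ‖Finsupp.linearCombination ℂ v a‖ := by
  have h : inner ℂ (Finsupp.linearCombination ℂ v (Finsupp.mapDomain (k * ·) a))
      (Finsupp.linearCombination ℂ v (Finsupp.mapDomain (k * ·) a)) =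
      inner ℂ (Finsupp.linearCombination ℂ v a) (Finsupp.linearCombination ℂ v a) := by
    rw [Finsupp.linearCombination_mapDomain]
    simp only [Finsupp.linearCombination_apply, Function.comp_apply, hv, Finsupp.sum, sum_inner, inner_sum, inner_smul_left,
      inner_smul_right]
  rw [@norm_eq_sqrt_re_inner ℂ, h, ← @norm_eq_sqrt_re_inner ℂ]

end OrbitMap

/-- Relative property (T) for orbit maps of isometric representations on inner product spaces
(in any universe, not necessarily complete). -/
theorem HasRelativePropertyT.exists_uniform_bound_orbit {G : Type u} [Group G] {H : Subgroup G}
    [H.Normal] (hT : HasRelativePropertyT H) :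
    ∃ C : ℝ, 0 ≤ C ∧ ∃ F : Finset G, ∀ (V : Type v) [NormedAddCommGroup V]
      [InnerProductSpace ℂ V] (w : G → V) (κ : ℝ),
      (∀ k g h, inner ℂ (w (k * g)) (w (k * h)) = inner ℂ (w g) (w h)) →
      0 ≤ κ → (∀ g ∈ F, ‖w g - w 1‖ ≤ κ) → ∀ h ∈ H, ‖w h - w 1‖ ≤ C * κ := by
  obtain ⟨C, hC, F, hF⟩ := hT.exists_uniform_bound
  refine ⟨C, hC, F, fun V _ _ w κ hw hκ hwF => ?_⟩
  -- Property (T) speaks of Hilbert spaces in the universe of `G`. The orbit is therefore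
  -- transported to the completion of `G →₀ ℂ` under the inner product pulled back from `V`: `G`
  -- acts there by translation, and the basis vector at 1 plays the role of `w 1`.
  let core := pulledBackCore w
  let : SeminormedAddCommGroup (G →₀ ℂ) :=
    InnerProductSpace.Core.toSeminormedAddCommGroup (𝕜 := ℂ) (c := core)
  let : InnerProductSpace ℂ (G →₀ ℂ) := InnerProductSpace.ofCore core
  have hnorm : ∀ a : G →₀ ℂ, ‖a‖ = ‖Finsupp.linearCombination ℂ w a‖ := fun a => by
    rw [@norm_eq_sqrt_re_inner ℂ, @norm_eq_sqrt_re_inner ℂ]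
    rfl
  let T : G → (G →₀ ℂ) →L[ℂ] (G →₀ ℂ) := fun g =>
    (LinearIsometry.mk (Finsupp.lmapDomain ℂ ℂ (g * ·)) fun a => by
      rw [hnorm, hnorm]
      exact norm_linearCombination_mapDomain w hw g a).toContinuousLinearMap
  have hT1 : ∀ g a, T g a = Finsupp.mapDomain (g * ·) a := fun g a => rfl
  let ρ : G →* (UniformSpace.Completion (G →₀ ℂ) →L[ℂ] UniformSpace.Completion (G →₀ ℂ)) :=
    { toFun := fun g => (T g).completion
      map_one' := by
        ext x
        induction x using UniformSpace.Completion.induction_on with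
        | hp => exact isClosed_eq (ContinuousLinearMap.continuous _)
                  (ContinuousLinearMap.continuous _)
        | ih a =>
          rw [ContinuousLinearMap.completion_apply_coe, hT1]
          simp [show (fun x : G => x) = id from rfl]
      map_mul' := fun g k => by
        ext x
        induction x using UniformSpace.Completion.induction_on with
        | hp => exact isClosed_eq (ContinuousLinearMap.continuous _)
                  (ContinuousLinearMap.continuous _)
        | ih a =>
          rw [mul_apply_eq_comp, ContinuousLinearMap.completion_apply_coe,
            ContinuousLinearMap.completion_apply_coe, ContinuousLinearMap.completion_apply_coe,
            hT1, hT1, hT1, ← Finsupp.mapDomain_comp]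
          congr 2
          funext x
          simp [mul_assoc] }
  have hρ : ∀ g x, ‖ρ g x‖ = ‖x‖ := by
    intro g x
    induction x using UniformSpace.Completion.induction_on with
    | hp => exact isClosed_eq (by fun_prop) (by fun_prop)
    | ih a =>
      change ‖(T g).completion a‖ = _
      rw [ContinuousLinearMap.completion_apply_coe, UniformSpace.Completion.norm_coe,
        UniformSpace.Completion.norm_coe]
      rw [hnorm, hnorm, hT1]
      exact norm_linearCombination_mapDomain w hw g a
  have key : ∀ g, ‖(unitaryRepOfNormEq ρ hρ g : UniformSpace.Completion (G →₀ ℂ) →L[ℂ]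
      UniformSpace.Completion (G →₀ ℂ)) ((Finsupp.single 1 1 : G →₀ ℂ) :
        UniformSpace.Completion (G →₀ ℂ)) - ((Finsupp.single 1 1 : G →₀ ℂ) :
        UniformSpace.Completion (G →₀ ℂ))‖ = ‖w g - w 1‖ := by
    intro g
    change ‖(T g).completion _ - _‖ = _
    rw [ContinuousLinearMap.completion_apply_coe, ← UniformSpace.Completion.coe_sub,
      UniformSpace.Completion.norm_coe, hnorm, hT1, Finsupp.mapDomain_single]
    simp
  intro h hh
  rw [← key]
  exact hF _ _ _ κ hκ (fun g hg => by rw [key]; exact hwF g hg) h hh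

/-! ### Rigidity estimates in the trace norm -/

section Tracial

variable {A : Type*} [NonUnitalRing A] [StarRing A]

/-- `u` is a unitary of the corner `p A p`. -/
structure IsCornerUnitary (p u : A) : Prop where
  star_mul_self : star u * u = p
  mul_star_self : u * star u = p
  mul_right : u * p = u

/-- `U` is a unitary representation of `G` in a corner of `A`. -/
structure IsCornerRep {G : Type*} [Group G] (U : G → A) : Prop where
  map_mul : ∀ g h, U (g * h) = U g * U h
  star_map : ∀ g, star (U g) = U g⁻¹

theorem IsCornerRep.isCornerUnitary {G : Type*} [Group G] {U : G → A} (hU : IsCornerRep U)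
    (g : G) : IsCornerUnitary (U 1) (U g) where
  star_mul_self := by rw [hU.star_map, ← hU.map_mul, inv_mul_cancel]
  mul_star_self := by rw [hU.star_map, ← hU.map_mul, mul_inv_cancel]
  mul_right := by rw [← hU.map_mul, mul_one]

variable [Module ℂ A] {V : Type v} [NormedAddCommGroup V] [InnerProductSpace ℂ V]

/-- `J` is the canonical map of a *-algebra into the `L²` space of a faithful positive trace `τ`,
so that `⟪J x, J y⟫ = τ (x⋆ y)`; this is expressed without mentioning `τ`. -/
structure IsTracialMap (J : A →ₗ[ℂ] V) : Prop where
  inner_mul_left : ∀ a x y, inner ℂ (J (a * x)) (J y) = inner ℂ (J x) (J (star a * y))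
  inner_star : ∀ x y, inner ℂ (J (star x)) (J (star y)) = inner ℂ (J y) (J x)
  injective : Function.Injective J

namespace IsTracialMap

variable {J : A →ₗ[ℂ] V} (hJ : IsTracialMap J)

include hJ

theorem inner_mul_right (a x y : A) :
    inner ℂ (J (x * a)) (J y) = inner ℂ (J x) (J (y * star a)) := by
  rw [← hJ.inner_star, star_mul, ← star_star a, ← hJ.inner_mul_left, ← hJ.inner_star, star_mul,
    star_star, star_star, star_star]

theorem norm_star (x : A) : ‖J (star x)‖ = ‖J x‖ := by
  rw [@norm_eq_sqrt_re_inner ℂ, hJ.inner_star, ← @norm_eq_sqrt_re_inner ℂ]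

/-- There is no operator norm on `A`. With p = u⋆u one has ‖J(ux)‖² = ⟪J x, J(px)⟫ and ‖J(px)‖ =
‖J(ux)‖, so Cauchy-Schwarz suffices. -/
theorem norm_mul_left_le {p u : A} (hu : IsCornerUnitary p u) (x : A) : ‖J (u * x)‖ ≤ ‖J x‖ := by
  have h1 : inner ℂ (J (u * x)) (J (u * x)) = inner ℂ (J x) (J (star u * u * x)) := by
    rw [hJ.inner_mul_left, mul_assoc]
  have hp : star u * u * (star u * u) = star u * u := by
    rw [mul_assoc, hu.star_mul_self, hu.mul_right, hu.star_mul_self]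
  have h2 : inner ℂ (J (star u * u * x)) (J (star u * u * x)) =
      inner ℂ (J x) (J (star u * u * x)) := by
    rw [hJ.inner_mul_left, star_mul, star_star, ← mul_assoc, hp]
  have h3 : ‖J (u * x)‖ = ‖J (star u * u * x)‖ := by
    rw [@norm_eq_sqrt_re_inner ℂ, h1, ← h2, ← @norm_eq_sqrt_re_inner ℂ]
  have h4 : ‖J (u * x)‖ ^ 2 ≤ ‖J x‖ * ‖J (u * x)‖ := by
    rw [← @inner_self_eq_norm_sq ℂ, h1]
    refine (RCLike.re_le_norm _).trans ((norm_inner_le_norm _ _).trans_eq ?_)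
    rw [h3]
  by_contra! h
  nlinarith [norm_nonneg (J x)]

theorem norm_mul_right_le {p u : A} (hu : IsCornerUnitary p u) (x : A) :
    ‖J (x * star u)‖ ≤ ‖J x‖ := by
  rw [← hJ.norm_star, star_mul, star_star, ← hJ.norm_star x]
  exact hJ.norm_mul_left_le hu _

/-- If two corner unitaries are close, then so are `u w⋆` and `p q`. -/
theorem norm_mul_star_sub_le {p q u w : A} (hu : IsCornerUnitary p u) (hp : IsCornerUnitary p p)
    {ε : ℝ} (hpq : ‖J p - J q‖ ≤ ε) (huw : ‖J u - J w‖ ≤ ε) :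
    ‖J (u * star w) - J (p * q)‖ ≤ 2 * ε := by
  have hpp : p * p = p := hp.mul_right
  have h : u * star w - p * q = u * star (w - u) + p * (p - q) := by
    rw [star_sub, mul_sub, mul_sub, hu.mul_star_self, hpp]
    abel
  rw [← map_sub, h, map_add]
  refine (norm_add_le _ _).trans ?_
  have h1 := hJ.norm_mul_left_le hu (star (w - u))
  have h2 := hJ.norm_mul_left_le hp (p - q)
  rw [hJ.norm_star, map_sub, norm_sub_rev] at h1
  rw [map_sub] at h2
  linarith

variable [IsScalarTower ℂ A A] [SMulCommClass ℂ A A] [StarModule ℂ A]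

/-- Quantitative rigidity: two representations of `G` in corners of `A` that are close in the
trace norm on a finite set of relative property (T), extended by unitaries with different
commutation relations with an element `t` of the rigid subgroup. -/
theorem norm_pow_sub_one_mul_le {G : Type u} [Group G] {H : Subgroup G} {C : ℝ} {F : Finset G}
    (hF : ∀ (w : G → V) (κ : ℝ),
      (∀ k g h, inner ℂ (w (k * g)) (w (k * h)) = inner ℂ (w g) (w h)) →
      0 ≤ κ → (∀ g ∈ F, ‖w g - w 1‖ ≤ κ) → ∀ h ∈ H, ‖w h - w 1‖ ≤ C * κ)
    {U W : G → A} (hU : IsCornerRep U) (hW : IsCornerRep W) {P Q : A}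
    (hP : IsCornerUnitary (U 1) P) (hQ : IsCornerUnitary (W 1) Q) {a b : ℂ} {t : G} (ht : t ∈ H)
    (ha : U t * P = a • (P * U t)) (hb : W t * Q = b • (Q * W t))
    (hab : ‖a * star b‖ = 1)
    {ε : ℝ} (hε : 0 ≤ ε) (h1 : ‖J (U 1) - J (W 1)‖ ≤ ε) (hPQ : ‖J P - J Q‖ ≤ ε)
    (hUW : ∀ g ∈ F, ‖J (U g) - J (W g)‖ ≤ ε) :
    ‖a * star b - 1‖ * ‖J (U 1 * W 1)‖ ≤ 4 * (1 + C) * ε := by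
  have hU1 := hU.isCornerUnitary 1
  have hW1 : star (W 1) = W 1 := by rw [hW.star_map, inv_one]
  have hw : ∀ g, ‖J (U g) - J (W g)‖ ≤ ε → ‖J (U g * star (W g)) - J (U 1 * star (W 1))‖ ≤
      2 * ε := fun g hg => by
    rw [hW1]
    exact hJ.norm_mul_star_sub_le (hU.isCornerUnitary g) hU1 h1 hg
  -- The vectors J(U g W g⋆) are permuted by y ↦ U k y W k⋆, which is isometric on them by the trace
  -- property. Property (T) can thus be applied to this orbit.
  have hinv : ∀ k g h : G, inner ℂ (J (U (k * g) * star (W (k * g))))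
      (J (U (k * h) * star (W (k * h)))) =
      inner ℂ (J (U g * star (W g))) (J (U h * star (W h))) := by
    intro k g h
    have e1 : ∀ g, U (k * g) * star (W (k * g)) = U k * (U g * star (W g) * star (W k)) := by
      intro g
      rw [hU.map_mul, hW.map_mul, star_mul]
      simp only [mul_assoc]
    rw [e1, hJ.inner_mul_left, hJ.inner_mul_right, star_star, e1]
    congr 2
    calc star (U k) * (U k * (U h * star (W h) * star (W k))) * W k
        = (star (U k) * U k * U h) * (star (W h) * (star (W k) * W k)) := by
          simp only [mul_assoc]
      _ = U h * star (W h) := by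
          rw [(hU.isCornerUnitary k).star_mul_self, ← hU.map_mul, one_mul,
            (hW.isCornerUnitary k).star_mul_self, hW.star_map, ← hW.map_mul, mul_one]
  have ht1 : ‖J (U t * star (W t)) - J (U 1 * star (W 1))‖ ≤ C * (2 * ε) :=
    hF (fun g => J (U g * star (W g))) (2 * ε) hinv (by positivity)
      (fun g hg => hw g (hUW g hg)) t ht
  set x := U 1 * star (W 1) with hx
  set y := U t * star (W t) with hy
  have hDx : P * x * star Q = P * star Q := by
    rw [hx, ← mul_assoc, hP.mul_right, mul_assoc, ← star_mul, hQ.mul_right]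
  have hD1 : ‖J (P * x * star Q) - J x‖ ≤ 2 * ε := by
    rw [hDx, hx, hW1]
    exact hJ.norm_mul_star_sub_le hP hU1 h1 hPQ
  have hEx : U t * x * star (W t) = y := by
    rw [hx, ← mul_assoc, ← hU.map_mul, mul_one, mul_assoc, ← star_mul, ← hW.map_mul, mul_one]
  have hcomm : U t * (P * x * star Q) * star (W t) = (a * star b) • (P * y * star Q) := by
    calc U t * (P * x * star Q) * star (W t)
        = (U t * P) * x * star (W t * Q) := by simp only [star_mul, mul_assoc]
      _ = (a * star b) • (P * (U t * x * star (W t)) * star Q) := by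
          rw [ha, hb, star_smul, star_mul]
          simp only [smul_mul_assoc, mul_smul_comm, smul_smul, mul_assoc, mul_comm]
      _ = _ := by rw [hEx]
  have hE : ‖J ((a * star b) • (P * y * star Q)) - J y‖ ≤ 2 * ε := by
    rw [← hcomm, ← hEx, ← map_sub, ← sub_mul, ← mul_sub]
    refine (hJ.norm_mul_right_le (hW.isCornerUnitary t) _).trans
      ((hJ.norm_mul_left_le (hU.isCornerUnitary t) _).trans ?_)
    rwa [map_sub]
  have hD : ‖J ((a * star b) • (P * y * star Q)) - J ((a * star b) • (P * x * star Q))‖ ≤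
      C * (2 * ε) := by
    rw [← map_sub, ← smul_sub, ← sub_mul, ← mul_sub, map_smul, norm_smul, hab, one_mul]
    refine (hJ.norm_mul_right_le hQ _).trans ((hJ.norm_mul_left_le hP _).trans ?_)
    rwa [map_sub]
  have hD' : ‖J ((a * star b) • (P * x * star Q)) - J ((a * star b) • x)‖ ≤ 2 * ε := by
    rw [map_smul, map_smul, ← smul_sub, norm_smul, hab, one_mul]
    exact hD1
  have hfin : ‖J ((a * star b) • x) - J x‖ ≤ 4 * (1 + C) * ε := by
    -- With c = a b̄, the chain c x, c P x Q⋆, c P y Q⋆, y, x has steps of length at most 2ε, 2Cε,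
    -- 2ε, 2Cε. The third step uses that exchanging U t · W t⋆ with P · Q⋆ costs the scalar c.
    have e : J ((a * star b) • x) - J x =
        -(J ((a * star b) • (P * x * star Q)) - J ((a * star b) • x)) +
        -(J ((a * star b) • (P * y * star Q)) - J ((a * star b) • (P * x * star Q))) +
        (J ((a * star b) • (P * y * star Q)) - J y) + (J y - J x) := by abel
    rw [e]
    refine (norm_add_le _ _).trans ?_
    have n1 := norm_add₃_le
      (a := -(J ((a * star b) • (P * x * star Q)) - J ((a * star b) • x)))
      (b := -(J ((a * star b) • (P * y * star Q)) - J ((a * star b) • (P * x * star Q))))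
      (c := J ((a * star b) • (P * y * star Q)) - J y)
    rw [norm_neg, norm_neg] at n1
    linarith
  rw [← norm_smul, sub_smul, one_smul, ← map_smul, ← hW1]
  exact hfin

end IsTracialMap

end Tracial

/-! ### Countability from separability -/

/-- A subset of a separable space, given as the image of a family, is countable if its points are
separated by positive distances that depend on one of the two points. -/
theorem Set.countable_of_separated {ι : Type*} {X : Type*} [PseudoMetricSpace X]
    [TopologicalSpace.SeparableSpace X] {S : Set ι} (f : ι → X) (c : ι → ℝ)
    (hc : ∀ a ∈ S, 0 < c a) (h : ∀ a ∈ S, ∀ b ∈ S, dist (f a) (f b) < c a → a = b) :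
    S.Countable := by
  rcases S.eq_empty_or_nonempty with rfl | ⟨a₀, -⟩
  · exact Set.countable_empty
  have : Nonempty X := ⟨f a₀⟩
  -- Each `a` is labelled by a scale below `c a` and by a point of a dense sequence within half that
  -- scale. Equal labels put two points closer than `c a`, so the labelling is injective on `S`.
  have h1 : ∀ a, ∃ m : ℕ, a ∈ S → 1 / ((m : ℝ) + 1) < c a := fun a => by
    by_cases ha : a ∈ S
    · obtain ⟨m, hm⟩ := exists_nat_one_div_lt (hc a ha)
      exact ⟨m, fun _ => hm⟩
    · exact ⟨0, fun h => absurd h ha⟩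
  choose m hm using h1
  have h2 : ∀ a, ∃ k : ℕ, dist (f a) (TopologicalSpace.denseSeq X k) < 1 / ((m a : ℝ) + 1) / 2 :=
    fun a => (TopologicalSpace.denseRange_denseSeq X).exists_dist_lt (f a) (by positivity)
  choose k hk using h2
  refine Set.MapsTo.countable_of_injOn (t := Set.univ) (f := fun a => (m a, k a))
    (fun _ _ => Set.mem_univ _) ?_ Set.countable_univ
  intro a ha b hb hab
  obtain ⟨e1, e2⟩ := Prod.mk.inj hab
  refine h a ha b hb (lt_of_le_of_lt ?_ (hm a ha))
  have ka := hk a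
  have kb := hk b
  rw [← e1, ← e2, dist_comm] at kb
  have := dist_triangle (f a) (TopologicalSpace.denseSeq X (k a)) (f b)
  linarith

/-- The circle has no small subgroups. -/
theorem Circle.eq_one_of_norm_pow_sub_one_le {c : Circle}
    (h : ∀ k : ℕ, ‖(c : ℂ) ^ k - 1‖ ≤ 1 / 2) : c = 1 := by
  -- Squaring z multiplies |z - 1| by |z + 1| ≥ 2 - 1/2, so the distance to 1 would grow
  -- geometrically.
  have key : ∀ j : ℕ, (3 / 2 : ℝ) ^ j * ‖(c : ℂ) - 1‖ ≤ ‖(c : ℂ) ^ 2 ^ j - 1‖ := by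
    intro j
    induction j with
    | zero => simp
    | succ j ih =>
      have h1 : (c : ℂ) ^ 2 ^ (j + 1) - 1 = ((c : ℂ) ^ 2 ^ j - 1) * ((c : ℂ) ^ 2 ^ j - 1 + 2) := by
        ring
      have h2 : 3 / 2 ≤ ‖(c : ℂ) ^ 2 ^ j - 1 + 2‖ := by
        have e := norm_sub_le ((c : ℂ) ^ 2 ^ j - 1 + 2) ((c : ℂ) ^ 2 ^ j - 1)
        rw [add_sub_cancel_left] at e
        have := h (2 ^ j)
        norm_num at e
        linarith
      rw [h1, norm_mul, pow_succ]
      nlinarith [norm_nonneg ((c : ℂ) ^ 2 ^ j - 1)]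
  by_contra hc
  have hpos : 0 < ‖(c : ℂ) - 1‖ := norm_pos_iff.2 (sub_ne_zero.2 fun e => hc (Circle.ext e))
  obtain ⟨j, hj⟩ := pow_unbounded_of_one_lt (1 / ‖(c : ℂ) - 1‖) (by norm_num : (1 : ℝ) < 3 / 2)
  rw [div_lt_iff₀ hpos] at hj
  linarith [key j, h (2 ^ j)]

section Countable

variable {A : Type*} [NonUnitalRing A] [StarRing A] [Module ℂ A] [IsScalarTower ℂ A A]
  [SMulCommClass ℂ A A] [StarModule ℂ A]
  {V : Type v} [NormedAddCommGroup V] [InnerProductSpace ℂ V]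

/-- A family of representations of a rigid pair in corners of `A`, indexed by a set of `α` in the
circle and extended by unitaries whose commutation relations depend on `α`, is countable. -/
theorem IsTracialMap.countable_of_rigid [TopologicalSpace.SeparableSpace V] {J : A →ₗ[ℂ] V}
    (hJ : IsTracialMap J) {G : Type u} [Group G] {H : Subgroup G} {C : ℝ} {F : Finset G}
    (hC : 0 ≤ C) (hF : ∀ (w : G → V) (κ : ℝ),
      (∀ k g h, inner ℂ (w (k * g)) (w (k * h)) = inner ℂ (w g) (w h)) →
      0 ≤ κ → (∀ g ∈ F, ‖w g - w 1‖ ≤ κ) → ∀ h ∈ H, ‖w h - w 1‖ ≤ C * κ)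
    {U : Circle → G → A} {P : Circle → A} (hU : ∀ α, IsCornerRep (U α))
    (hP : ∀ α, IsCornerUnitary (U α 1) (P α)) {t : ℕ → G} (ht : ∀ k, t k ∈ H)
    (hcomm : ∀ α k, U α (t k) * P α = ((α : ℂ) ^ k) • (P α * U α (t k)))
    {S : Set Circle} (hne : ∀ α ∈ S, U α 1 ≠ 0) : S.Countable := by
  replace hne : ∀ α ∈ S, 0 < ‖J (U α 1)‖ := fun α hα => by
    rw [norm_pos_iff, ← map_zero J, hJ.injective.ne_iff]
    exact hne α hα
  refine Set.countable_of_separated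
    (f := fun α => ((fun g : F => J (U α g)), J (U α 1), J (P α)))
    (c := fun α => ‖J (U α 1)‖ / (8 * (1 + C) + 1)) (fun α hα => div_pos (hne α hα) (by positivity))
    fun α hα β hβ hdist => ?_
  rw [Prod.dist_eq, Prod.dist_eq, max_lt_iff, max_lt_iff] at hdist
  obtain ⟨d1, d2, d3⟩ := hdist
  -- This ε makes ‖J(U α 1)‖ - ε equal to 8(1 + C)ε, a lower bound for ‖J(U α 1 · U β 1)‖. Against
  -- the rigidity bound 4(1 + C)ε it leaves exactly 1/2.
  set ε := ‖J (U α 1)‖ / (8 * (1 + C) + 1) with hε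
  have hεpos : 0 < ε := div_pos (hne α hα) (by positivity)
  have hεC : ε * (8 * (1 + C) + 1) = ‖J (U α 1)‖ := div_mul_cancel₀ _ (by positivity)
  rw [dist_eq_norm] at d2 d3
  have hFd : ∀ g ∈ F, ‖J (U α g) - J (U β g)‖ ≤ ε := fun g hg => by
    rw [← dist_eq_norm]
    exact (dist_le_pi_dist (fun g : F => J (U α g)) (fun g : F => J (U β g)) ⟨g, hg⟩).trans d1.le
  have hx : ‖J (U α 1)‖ - ε ≤ ‖J (U α 1 * U β 1)‖ := by
    have h1 := hJ.norm_mul_left_le ((hU α).isCornerUnitary 1) (U α 1 - U β 1)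
    rw [mul_sub, ← (hU α).map_mul, mul_one, map_sub, map_sub] at h1
    have h2 := norm_sub_norm_le (J (U α 1)) (J (U α 1 * U β 1))
    linarith
  have hc : α * β⁻¹ = 1 := by
    refine Circle.eq_one_of_norm_pow_sub_one_le fun k => ?_
    have hbound := hJ.norm_pow_sub_one_mul_le hF (hU α) (hU β) (hP α) (hP β)
      (ht k) (hcomm α k) (hcomm β k)
      (by simp only [norm_mul, _root_.norm_star, norm_pow, Circle.norm_coe, one_pow, mul_one]) hεpos.le d2.le d3.le hFd
    have hcoe : (α : ℂ) ^ k * star ((β : ℂ) ^ k) = ((α * β⁻¹ : Circle) : ℂ) ^ k := by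
      rw [star_pow, Circle.coe_mul, mul_pow, Circle.coe_inv_eq_conj]
      rfl
    rw [hcoe] at hbound
    have hpos : 0 < ‖J (U α 1 * U β 1)‖ := by nlinarith
    refine le_of_mul_le_mul_right (hbound.trans ?_) hpos
    nlinarith
  rwa [mul_inv_eq_one] at hc

end Countable

/-! ### The canonical unitaries of a cocycle group algebra -/

section TwistedUnitary

variable {G : Type u} [Group G] {μ : G → G → Circle}

theorem twistedLeftRegular_mem (μ : G → G → Circle) (g : G) :
    (twistedLeftRegular μ g : lp (fun _ : G => ℂ) 2 →L[ℂ] lp (fun _ : G => ℂ) 2) ∈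
      (twistedGroupVN μ).toStarSubalgebra := by
  change _ ∈ (twistedGroupVN μ : Set (lp (fun _ : G => ℂ) 2 →L[ℂ] lp (fun _ : G => ℂ) 2))
  rw [coe_twistedGroupVN]
  exact Set.subset_centralizer_centralizer ⟨g, rfl⟩

/-- The unitary `λ_μ(g)` as an element of `L_μ(G)`. -/
noncomputable def twistedUnitary (μ : G → G → Circle) (g : G) :
    (twistedGroupVN μ).toStarSubalgebra :=
  ⟨_, twistedLeftRegular_mem μ g⟩

theorem twistedUnitary_star_mul (g : G) : star (twistedUnitary μ g) * twistedUnitary μ g = 1 :=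
  Subtype.ext (Unitary.mem_iff.1
    (Unitary.linearIsometryEquiv.symm (twistedLeftRegular μ g)).2).1

theorem twistedUnitary_mul_star (g : G) : twistedUnitary μ g * star (twistedUnitary μ g) = 1 :=
  Subtype.ext (Unitary.mem_iff.1
    (Unitary.linearIsometryEquiv.symm (twistedLeftRegular μ g)).2).2

theorem twistedLeftRegular_apply (g k : G) (f : lp (fun _ : G => ℂ) 2) :
    (twistedLeftRegular μ g f) k = (μ g (g⁻¹ * k) : ℂ) * f (g⁻¹ * k) := rfl

theorem twistedUnitary_mul (hμ : IsScalarTwoCocycle μ) (g h : G) :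
    twistedUnitary μ g * twistedUnitary μ h = (μ g h : ℂ) • twistedUnitary μ (g * h) := by
  apply Subtype.ext
  ext f k
  change (twistedLeftRegular μ g (twistedLeftRegular μ h f)) k =
    (μ g h : ℂ) * (twistedLeftRegular μ (g * h) f) k
  have h1 := hμ g h ((g * h)⁻¹ * k)
  have h2 : h * ((g * h)⁻¹ * k) = g⁻¹ * k := by group
  have h3 : h⁻¹ * (g⁻¹ * k) = (g * h)⁻¹ * k := by group
  rw [h2] at h1
  simp only [twistedLeftRegular_apply]
  rw [h3, ← mul_assoc, ← mul_assoc, ← Circle.coe_mul, ← Circle.coe_mul, h1, mul_comm (μ g _)]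

theorem twistedUnitary_one (h1 : ∀ g, μ 1 g = 1) : twistedUnitary μ 1 = 1 := by
  apply Subtype.ext
  ext f k
  change (twistedLeftRegular μ 1 f) k = f k
  simp [twistedLeftRegular_apply, h1]

theorem twistedUnitary_ne_zero (g : G) : twistedUnitary μ g ≠ 0 := by
  classical
  intro h
  have h1 : (twistedLeftRegular μ g : lp (fun _ : G => ℂ) 2 →L[ℂ] lp (fun _ : G => ℂ) 2) = 0 :=
    congrArg Subtype.val h
  have h2 : twistedLeftRegular μ g (lp.single 2 1 (1 : ℂ)) = 0 := DFunLike.congr_fun h1 _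
  have h3 : ‖(lp.single 2 1 (1 : ℂ) : lp (fun _ : G => ℂ) 2)‖ = 0 := by
    rw [← (twistedLeftRegular μ g).norm_map, h2, norm_zero]
  rw [lp.norm_single (by norm_num)] at h3
  simp at h3

end TwistedUnitary

/-! ### Commutation relations and the rigid copy of ℤⁿ ⋊ Γ -/

section Lattice

open Matrix

variable {n : ℕ} {Γ : Subgroup (GeneralLinearGroup (Fin n) ℤ)}

theorem symplecticForm_sumElim (x₁ x₂ y₁ y₂ : Fin n → ℤ) :
    symplecticForm (Sum.elim x₁ x₂) (Sum.elim y₁ y₂) = x₁ ⬝ᵥ y₂ - x₂ ⬝ᵥ y₁ := by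
  simp [symplecticForm, fromBlocks_mulVec, sumElim_dotProduct_sumElim, sub_eq_add_neg,
    Matrix.neg_mulVec]

theorem symplecticForm_swap (x y : Fin n ⊕ Fin n → ℤ) :
    symplecticForm x y = -symplecticForm y x := by
  rw [← Sum.elim_comp_inl_inr x, ← Sum.elim_comp_inl_inr y, symplecticForm_sumElim,
    symplecticForm_sumElim, dotProduct_comm (y ∘ Sum.inl), dotProduct_comm (y ∘ Sum.inr)]
  ring

theorem symplecticCocycle_one_left (β : Circle) (g : DoubledGroup Γ) :
    symplecticCocycle Γ β 1 g = 1 := by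
  simp [symplecticCocycle, symplecticForm]

theorem symplecticCocycle_inl (β : Circle) (x y : Fin n ⊕ Fin n → ℤ) :
    symplecticCocycle Γ β (SemidirectProduct.inl (Multiplicative.ofAdd x))
      (SemidirectProduct.inl (Multiplicative.ofAdd y)) = β ^ symplecticForm x y := by
  simp [symplecticCocycle]

/-- The translations satisfy the canonical commutation relations. -/
theorem twistedUnitary_inl_comm {β : Circle} (x y : Fin n ⊕ Fin n → ℤ) :
    twistedUnitary (symplecticCocycle Γ β) (SemidirectProduct.inl (Multiplicative.ofAdd x)) *
      twistedUnitary (symplecticCocycle Γ β) (SemidirectProduct.inl (Multiplicative.ofAdd y)) =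
    (((β ^ 2) ^ symplecticForm x y : Circle) : ℂ) •
      (twistedUnitary (symplecticCocycle Γ β) (SemidirectProduct.inl (Multiplicative.ofAdd y)) *
      twistedUnitary (symplecticCocycle Γ β)
        (SemidirectProduct.inl (Multiplicative.ofAdd x))) := by
  rw [twistedUnitary_mul (isScalarTwoCocycle_symplecticCocycle Γ β),
    twistedUnitary_mul (isScalarTwoCocycle_symplecticCocycle Γ β), symplecticCocycle_inl,
    symplecticCocycle_inl, symplecticForm_swap y x, smul_smul, ← Circle.coe_mul, ← map_mul SemidirectProduct.inl,
    ← map_mul SemidirectProduct.inl, mul_comm (Multiplicative.ofAdd x)]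
  congr 2
  rw [← zpow_natCast, ← _root_.zpow_mul, ← _root_.zpow_add]
  congr 1
  push_cast
  ring

/-- The embedding of `ℤⁿ ⋊ Γ` into `ℤ²ⁿ ⋊ Γ` through the first summand of `ℤ²ⁿ`. -/
def firstCopy (g : LatticeSemidirect Γ.subtype) : DoubledGroup Γ :=
  ⟨Multiplicative.ofAdd (Sum.elim g.left.toAdd 0), g.right⟩

theorem doubling_mulVec_sumElim (g : GeneralLinearGroup (Fin n) ℤ) (x y : Fin n → ℤ) :
    (doubling n g : Matrix (Fin n ⊕ Fin n) (Fin n ⊕ Fin n) ℤ) *ᵥ Sum.elim x y =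
      Sum.elim ((g : Matrix (Fin n) (Fin n) ℤ) *ᵥ x)
        (((g⁻¹ : GeneralLinearGroup (Fin n) ℤ) : Matrix (Fin n) (Fin n) ℤ)ᵀ *ᵥ y) := by
  simp [doubling, fromBlocks_mulVec, -coe_units_inv]

theorem firstCopy_mul (g h : LatticeSemidirect Γ.subtype) :
    firstCopy (g * h) = firstCopy g * firstCopy h := by
  refine SemidirectProduct.ext ?_ rfl
  change Multiplicative.ofAdd (Sum.elim (g.left.toAdd +
    ((g.right : GeneralLinearGroup (Fin n) ℤ) : Matrix (Fin n) (Fin n) ℤ) *ᵥ h.left.toAdd) 0) =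
    Multiplicative.ofAdd (Sum.elim g.left.toAdd 0 +
    (doubling n g.right : Matrix (Fin n ⊕ Fin n) (Fin n ⊕ Fin n) ℤ) *ᵥ Sum.elim h.left.toAdd 0)
  rw [doubling_mulVec_sumElim]
  congr 1
  ext (i | i) <;> simp

theorem firstCopy_one : firstCopy (1 : LatticeSemidirect Γ.subtype) = 1 := by
  refine SemidirectProduct.ext ?_ rfl
  change Multiplicative.ofAdd (Sum.elim (0 : Fin n → ℤ) 0) = Multiplicative.ofAdd 0
  congr 1
  ext (i | i) <;> rfl

/-- The first summand is isotropic for ν and preserved by θ(Γ). Hence λ is an honest representation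
on this copy, as property (T) requires. -/
theorem symplecticCocycle_firstCopy (β : Circle) (g h : LatticeSemidirect Γ.subtype) :
    symplecticCocycle Γ β (firstCopy g) (firstCopy h) = 1 := by
  have : symplecticForm (Sum.elim g.left.toAdd 0)
      ((doubling n g.right : Matrix (Fin n ⊕ Fin n) (Fin n ⊕ Fin n) ℤ) *ᵥ
        Sum.elim h.left.toAdd 0) = 0 := by
    rw [doubling_mulVec_sumElim, symplecticForm_sumElim]
    simp
  exact (congrArg (β ^ ·) this).trans (zpow_zero β)

instance latticeSubgroup_normal {Δ : Type} [Group Δ] {ι : Type} [Fintype ι] [DecidableEq ι]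
    (ρ : Δ →* GeneralLinearGroup ι ℤ) : (latticeSubgroup ρ).Normal := by
  unfold latticeSubgroup
  rw [SemidirectProduct.range_inl_eq_ker_rightHom]
  infer_instance

section Map

variable {A : Type*} [NonUnitalRing A] [StarRing A] [Module ℂ A]
  {B : Type*} [Ring B] [StarRing B] [Algebra ℂ B]

theorem IsCornerRep.map {G : Type*} [Group G] {U : G → B} (hU : IsCornerRep U)
    (φ : B →⋆ₙₐ[ℂ] A) : IsCornerRep fun g => φ (U g) where
  map_mul g h := by rw [hU.map_mul, _root_.map_mul]
  star_map g := by rw [← map_star, hU.star_map]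

theorem IsCornerUnitary.map {p u : B} (hu : IsCornerUnitary p u) (φ : B →⋆ₙₐ[ℂ] A) :
    IsCornerUnitary (φ p) (φ u) where
  star_mul_self := by rw [← map_star, ← map_mul, hu.star_mul_self]
  mul_star_self := by rw [← map_star, ← map_mul, hu.mul_star_self]
  mul_right := by rw [← map_mul, hu.mul_right]

theorem NonUnitalStarAlgHom.map_commutation {u v : B} {c : ℂ} (h : u * v = c • (v * u))
    (φ : B →⋆ₙₐ[ℂ] A) : φ u * φ v = c • (φ v * φ u) := by
  rw [← map_mul, h, map_smul, map_mul]

theorem NonUnitalStarAlgHom.map_ne_zero_of_injective {φ : B →⋆ₙₐ[ℂ] A}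
    (hφ : Function.Injective φ) {u : B} (hu : u ≠ 0) : φ u ≠ 0 :=
  (map_ne_zero_iff φ hφ).2 hu

end Map

section Embedding

variable {A : Type*} [NonUnitalRing A] [StarRing A] [Module ℂ A] [IsScalarTower ℂ A A]
  [SMulCommClass ℂ A A] [StarModule ℂ A]

theorem isCornerRep_firstCopy (β : Circle) :
    IsCornerRep fun g : LatticeSemidirect Γ.subtype =>
      twistedUnitary (symplecticCocycle Γ β) (firstCopy g) := by
  have hmul : ∀ g h : LatticeSemidirect Γ.subtype,
      twistedUnitary (symplecticCocycle Γ β) (firstCopy (g * h)) =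
      twistedUnitary (symplecticCocycle Γ β) (firstCopy g) *
      twistedUnitary (symplecticCocycle Γ β) (firstCopy h) := fun g h => by
    rw [twistedUnitary_mul (isScalarTwoCocycle_symplecticCocycle Γ β), ← firstCopy_mul,
      symplecticCocycle_firstCopy, Circle.coe_one, one_smul]
  refine ⟨hmul, fun g => ?_⟩
  have h1 : twistedUnitary (symplecticCocycle Γ β) (firstCopy g) *
      twistedUnitary (symplecticCocycle Γ β) (firstCopy g⁻¹) = 1 := by
    rw [← hmul, mul_inv_cancel, firstCopy_one, twistedUnitary_one (symplecticCocycle_one_left β)]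
  exact left_inv_eq_right_inv (twistedUnitary_star_mul _) h1

theorem isCornerUnitary_twistedUnitary (β : Circle) (g : DoubledGroup Γ) :
    IsCornerUnitary (twistedUnitary (symplecticCocycle Γ β)
      (firstCopy (1 : LatticeSemidirect Γ.subtype)))
      (twistedUnitary (symplecticCocycle Γ β) g) := by
  rw [firstCopy_one, twistedUnitary_one (symplecticCocycle_one_left β)]
  exact ⟨twistedUnitary_star_mul _, twistedUnitary_mul_star _, mul_one _⟩

variable {V : Type v} [NormedAddCommGroup V] [InnerProductSpace ℂ V]

/-- Only countably many of the algebras `M_α` embed into a *-algebra that has a faithful trace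
with a separable `L²` space. -/
theorem countable_setOf_embeds [TopologicalSpace.SeparableSpace V] (hn : 1 ≤ n)
    (hT : HasRelativePropertyT (latticeSubgroup Γ.subtype))
    (r : Circle → Circle) (hr : ∀ α, r α ^ 2 = α) {J : A →ₗ[ℂ] V} (hJ : IsTracialMap J) :
    {α : Circle | ∃ φ : (twistedGroupVN (symplecticCocycle Γ (r α))).toStarSubalgebra →⋆ₙₐ[ℂ] A,
      Function.Injective φ}.Countable := by
  classical
  obtain ⟨C, hC, F, hF⟩ := hT.exists_uniform_bound_orbit
  set S := {α : Circle | ∃ φ : (twistedGroupVN (symplecticCocycle Γ (r α))).toStarSubalgebra →⋆ₙₐ[ℂ] A,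
      Function.Injective φ}
  have hφ : ∀ α : Circle, ∃ φ : (twistedGroupVN (symplecticCocycle Γ (r α))).toStarSubalgebra →⋆ₙₐ[ℂ] A,
      α ∈ S → Function.Injective φ := fun α => by
    by_cases h : α ∈ S
    · obtain ⟨φ, h⟩ := h
      exact ⟨φ, fun _ => h⟩
    -- The zero homomorphism keeps all corner and commutation relations valid for every α; only
    -- nonvanishing is restricted to `S`.
    · exact ⟨0, fun h' => absurd h' h⟩
  choose φ hφ using hφ
  let e : Fin n → ℤ := Pi.single ⟨0, hn⟩ 1
  let U : Circle → LatticeSemidirect Γ.subtype → A := fun α g =>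
    φ α (twistedUnitary (symplecticCocycle Γ (r α)) (firstCopy g))
  let P : Circle → A := fun α => φ α (twistedUnitary (symplecticCocycle Γ (r α))
    (SemidirectProduct.inl (Multiplicative.ofAdd (Sum.elim 0 e))))
  have hU : ∀ α, IsCornerRep (U α) := fun α => (isCornerRep_firstCopy (r α)).map (φ α)
  have hP : ∀ α, IsCornerUnitary (U α 1) (P α) := fun α =>
    (isCornerUnitary_twistedUnitary (r α) _).map (φ α)
  -- Since ν((k e, 0), (0, e)) = k, the commutation scalar of `t k` with `P α` is (r α)^(2k) = α^k.
  let t : ℕ → LatticeSemidirect Γ.subtype := fun k =>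
    SemidirectProduct.inl (Multiplicative.ofAdd ((k : ℤ) • e))
  have hcomm : ∀ α k, U α (t k) * P α = ((α : ℂ) ^ k) • (P α * U α (t k)) := by
    intro α k
    have h := twistedUnitary_inl_comm (Γ := Γ) (β := r α)
      (Sum.elim ((k : ℤ) • e) 0) (Sum.elim 0 e)
    have hν : symplecticForm (Sum.elim ((k : ℤ) • e) 0) (Sum.elim 0 e) = k := by
      rw [symplecticForm_sumElim]
      simp [e]
    rw [hν, hr, zpow_natCast, Circle.coe_pow] at h
    exact NonUnitalStarAlgHom.map_commutation h (φ α)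
  have hne : ∀ α ∈ S, U α 1 ≠ 0 := fun α hα =>
    NonUnitalStarAlgHom.map_ne_zero_of_injective (hφ α hα) (twistedUnitary_ne_zero _)
  exact hJ.countable_of_rigid hC (hF V) hU hP (t := t) (fun k => ⟨_, rfl⟩) hcomm hne

end Embedding

end Lattice

/-! ### Fourier coefficients and the canonical trace -/

section RightRegular

variable {G : Type u} [Group G] {μ : G → G → Circle}

/-- The operator of `ℓ²(G)` that maps `ξ_k` to `μ(k, h) ξ_{kh}`. -/
noncomputable def twistedRightRegular (μ : G → G → Circle) (h : G) :
    lp (fun _ : G => ℂ) 2 →ₗᵢ[ℂ] lp (fun _ : G => ℂ) 2 where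
  toFun f := ⟨fun k => (μ (k * h⁻¹) h : ℂ) * f (k * h⁻¹),
    memℓp_twist (fun k => μ (k * h⁻¹) h) (Equiv.mulRight h⁻¹) f⟩
  map_add' f f' := by
    ext k
    exact mul_add _ _ _
  map_smul' c f := by
    ext k
    simp [mul_left_comm]
  norm_map' f := by
    have h2 : (0 : ℝ) < (2 : ENNReal).toReal := by norm_num
    rw [lp.norm_eq_tsum_rpow h2, lp.norm_eq_tsum_rpow h2,
      ← (Equiv.mulRight h⁻¹).tsum_eq (fun k => ‖f k‖ ^ (2 : ENNReal).toReal)]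
    congr 1
    refine tsum_congr fun k => ?_
    change ‖(μ (k * h⁻¹) h : ℂ) * f (k * h⁻¹)‖ ^ (2 : ENNReal).toReal = _
    rw [norm_mul, Circle.norm_coe, one_mul, Equiv.coe_mulRight]

theorem twistedRightRegular_apply (h k : G) (f : lp (fun _ : G => ℂ) 2) :
    (twistedRightRegular μ h f) k = (μ (k * h⁻¹) h : ℂ) * f (k * h⁻¹) := rfl

/-- This is the cocycle identity for the triple g, g⁻¹kh⁻¹, h. -/
theorem twistedLeftRegular_comm_right (hμ : IsScalarTwoCocycle μ) (g h : G)
    (f : lp (fun _ : G => ℂ) 2) :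
    twistedLeftRegular μ g (twistedRightRegular μ h f) =
      twistedRightRegular μ h (twistedLeftRegular μ g f) := by
  ext k
  simp only [twistedLeftRegular_apply, twistedRightRegular_apply]
  have h1 := hμ g (g⁻¹ * k * h⁻¹) h
  have h2 : g * (g⁻¹ * k * h⁻¹) = k * h⁻¹ := by group
  have h3 : g⁻¹ * k * h⁻¹ * h = g⁻¹ * k := by group
  rw [h2, h3] at h1
  rw [← mul_assoc g⁻¹, ← mul_assoc, ← mul_assoc, ← Circle.coe_mul, ← Circle.coe_mul,
    mul_comm (μ (k * h⁻¹) h), h1, mul_comm (μ g _)]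

theorem twistedGroupVN_comm_right (hμ : IsScalarTwoCocycle μ)
    (x : (twistedGroupVN μ).toStarSubalgebra) (h : G) (f : lp (fun _ : G => ℂ) 2) :
    (x : lp (fun _ : G => ℂ) 2 →L[ℂ] lp (fun _ : G => ℂ) 2) (twistedRightRegular μ h f) =
      twistedRightRegular μ h
        ((x : lp (fun _ : G => ℂ) 2 →L[ℂ] lp (fun _ : G => ℂ) 2) f) := by
  have hx : (x : lp (fun _ : G => ℂ) 2 →L[ℂ] lp (fun _ : G => ℂ) 2) ∈
      (twistedGroupVN μ : Set (lp (fun _ : G => ℂ) 2 →L[ℂ] lp (fun _ : G => ℂ) 2)) := x.2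
  rw [coe_twistedGroupVN] at hx
  have hR : (twistedRightRegular μ h).toContinuousLinearMap ∈ Set.centralizer (Set.range fun g =>
      (twistedLeftRegular μ g : lp (fun _ : G => ℂ) 2 →L[ℂ] lp (fun _ : G => ℂ) 2)) := by
    rintro _ ⟨g, rfl⟩
    ext1 f
    exact twistedLeftRegular_comm_right hμ g h f
  exact (DFunLike.congr_fun (hx _ hR) f).symm

theorem IsScalarTwoCocycle.one_right (hμ : IsScalarTwoCocycle μ) (h1 : ∀ g, μ 1 g = 1) (g : G) :
    μ g 1 = 1 := by
  have := hμ g 1 1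
  rw [mul_one, mul_one, h1, one_mul] at this
  exact mul_eq_left.1 this

theorem IsScalarTwoCocycle.inv_comm (hμ : IsScalarTwoCocycle μ) (h1 : ∀ g, μ 1 g = 1) (g : G) :
    μ g g⁻¹ = μ g⁻¹ g := by
  have := hμ g g⁻¹ g
  rwa [mul_inv_cancel, inv_mul_cancel, h1, hμ.one_right h1, mul_one, mul_one] at this

variable [DecidableEq G]

theorem twistedRightRegular_single_one (h1 : ∀ g, μ 1 g = 1) (h : G) :
    twistedRightRegular μ h (lp.single 2 1 (1 : ℂ)) = lp.single 2 h (1 : ℂ) := by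
  ext k
  rw [twistedRightRegular_apply]
  by_cases hk : k = h
  · subst hk
    simp [h1]
  · have hk' : k * h⁻¹ ≠ 1 := fun e => hk (mul_inv_eq_one.1 e)
    simp [lp.single_apply, hk, hk']

/-- The Fourier coefficient of `x` at `g`. -/
noncomputable def twistedCoeff (x : (twistedGroupVN μ).toStarSubalgebra) (g : G) : ℂ :=
  ((x : lp (fun _ : G => ℂ) 2 →L[ℂ] lp (fun _ : G => ℂ) 2) (lp.single 2 1 (1 : ℂ))) g

/-- The vector ξ_h is a right translate of ξ_1, and right translations commute with x. So the vector
x ξ_1 determines the whole matrix of x. -/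
theorem apply_single_apply (hμ : IsScalarTwoCocycle μ) (h1 : ∀ g, μ 1 g = 1)
    (x : (twistedGroupVN μ).toStarSubalgebra) (h k : G) :
    ((x : lp (fun _ : G => ℂ) 2 →L[ℂ] lp (fun _ : G => ℂ) 2) (lp.single 2 h (1 : ℂ))) k =
      μ (k * h⁻¹) h * twistedCoeff x (k * h⁻¹) := by
  rw [← twistedRightRegular_single_one h1 h, twistedGroupVN_comm_right hμ,
    twistedRightRegular_apply]
  rfl

theorem ext_twistedCoeff (hμ : IsScalarTwoCocycle μ) (h1 : ∀ g, μ 1 g = 1)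
    {x y : (twistedGroupVN μ).toStarSubalgebra}
    (hxy : ∀ g, twistedCoeff x g = twistedCoeff y g) : x = y := by
  apply Subtype.ext
  refine lp.ext_continuousLinearMap (by norm_num) fun g => ?_
  ext k
  change ((x : lp (fun _ : G => ℂ) 2 →L[ℂ] lp (fun _ : G => ℂ) 2) (lp.single 2 g (1 : ℂ))) k =
    ((y : lp (fun _ : G => ℂ) 2 →L[ℂ] lp (fun _ : G => ℂ) 2) (lp.single 2 g (1 : ℂ))) k
  rw [apply_single_apply hμ h1, apply_single_apply hμ h1, hxy]

/-- The canonical trace `x ↦ ⟪ξ_1, x ξ_1⟫`. -/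
noncomputable def twistedTrace (μ : G → G → Circle) :
    (twistedGroupVN μ).toStarSubalgebra →ₗ[ℂ] ℂ where
  toFun x := twistedCoeff x 1
  map_add' _ _ := rfl
  map_smul' _ _ := rfl

theorem twistedTrace_eq_inner (x : (twistedGroupVN μ).toStarSubalgebra) :
    twistedTrace μ x = inner ℂ (lp.single 2 1 (1 : ℂ) : lp (fun _ : G => ℂ) 2)
      ((x : lp (fun _ : G => ℂ) 2 →L[ℂ] lp (fun _ : G => ℂ) 2) (lp.single 2 1 (1 : ℂ))) := by
  rw [lp.inner_single_left]
  simp [twistedTrace, twistedCoeff]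

/-- The trace property can be read off: substituting k⁻¹ for k exchanges x and y, because μ(k, k⁻¹)
= μ(k⁻¹, k). -/
theorem twistedTrace_mul (hμ : IsScalarTwoCocycle μ) (h1 : ∀ g, μ 1 g = 1)
    (x y : (twistedGroupVN μ).toStarSubalgebra) :
    twistedTrace μ (x * y) = ∑' k, μ k⁻¹ k * twistedCoeff x k⁻¹ * twistedCoeff y k := by
  rw [twistedTrace_eq_inner]
  change inner ℂ _ ((x : lp (fun _ : G => ℂ) 2 →L[ℂ] lp (fun _ : G => ℂ) 2)
    ((y : lp (fun _ : G => ℂ) 2 →L[ℂ] lp (fun _ : G => ℂ) 2) (lp.single 2 1 (1 : ℂ)))) = _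
  rw [← ContinuousLinearMap.adjoint_inner_left, lp.inner_eq_tsum]
  refine tsum_congr fun k => ?_
  have h2 := apply_single_apply hμ h1 x k 1
  have h3 : inner ℂ (ContinuousLinearMap.adjoint
      (x : lp (fun _ : G => ℂ) 2 →L[ℂ] lp (fun _ : G => ℂ) 2) (lp.single 2 1 (1 : ℂ)))
      (lp.single 2 k (1 : ℂ)) = μ k⁻¹ k * twistedCoeff x k⁻¹ := by
    rw [ContinuousLinearMap.adjoint_inner_left, lp.inner_single_left, h2]
    simp
  rw [lp.inner_single_right] at h3
  rw [← h3, RCLike.inner_apply, RCLike.inner_apply, one_mul, mul_comm]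
  rfl

theorem isFaithfulNormalTrace_twistedTrace (hμ : IsScalarTwoCocycle μ) (h1 : ∀ g, μ 1 g = 1) :
    IsFaithfulNormalTrace (twistedGroupVN μ) (twistedTrace μ) where
  map_one := by
    rw [twistedTrace_eq_inner]
    change inner ℂ _ (lp.single 2 1 (1 : ℂ) : lp (fun _ : G => ℂ) 2) = 1
    rw [lp.inner_single_left]
    simp
  tracial x y := by
    rw [twistedTrace_mul hμ h1, twistedTrace_mul hμ h1, ← (Equiv.inv G).tsum_eq]
    refine tsum_congr fun k => ?_
    rw [Equiv.inv_apply, inv_inv, hμ.inv_comm h1]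
    ring
  faithful x hx := by
    rw [twistedTrace_eq_inner] at hx
    change inner ℂ _ (ContinuousLinearMap.adjoint
      (x : lp (fun _ : G => ℂ) 2 →L[ℂ] lp (fun _ : G => ℂ) 2)
      ((x : lp (fun _ : G => ℂ) 2 →L[ℂ] lp (fun _ : G => ℂ) 2) (lp.single 2 1 (1 : ℂ)))) = 0 at hx
    rw [ContinuousLinearMap.adjoint_inner_right, inner_self_eq_zero] at hx
    refine ext_twistedCoeff hμ h1 fun g => ?_
    exact congrArg (fun f : lp (fun _ : G => ℂ) 2 => f g) hx
  normal := by
    -- The trace is a single vector functional; the sequence is padded with zeros.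
    refine ⟨Pi.single 0 (lp.single 2 1 1), ?_, fun x => ?_⟩
    · refine summable_of_ne_finset_zero (s := {0}) fun i hi => ?_
      rw [Pi.single_eq_of_ne (by simpa using hi)]
      simp
    · rw [twistedTrace_eq_inner]
      convert hasSum_single (f := fun i => inner ℂ ((Pi.single 0 (lp.single 2 1 1) :
        ℕ → lp (fun _ : G => ℂ) 2) i) ((x : lp (fun _ : G => ℂ) 2 →L[ℂ] lp (fun _ : G => ℂ) 2)
        ((Pi.single 0 (lp.single 2 1 1) : ℕ → lp (fun _ : G => ℂ) 2) i))) 0 ?_ using 1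
      · simp
      · intro i hi
        rw [Pi.single_eq_of_ne hi, inner_zero_left]

theorem twistedCoeff_twistedUnitary (h1 : ∀ g, μ 1 g = 1) (hμ : IsScalarTwoCocycle μ) (g k : G) :
    twistedCoeff (twistedUnitary μ g) k = (lp.single 2 g (1 : ℂ) : lp (fun _ : G => ℂ) 2) k := by
  have := twistedLeftRegular_single μ g 1
  rw [hμ.one_right h1, Circle.coe_one, one_smul, mul_one] at this
  exact congrArg (fun f : lp (fun _ : G => ℂ) 2 => f k) this

theorem not_finiteDimensional_twistedGroupVN [Infinite G] (hμ : IsScalarTwoCocycle μ)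
    (h1 : ∀ g, μ 1 g = 1) : ¬ FiniteDimensional ℂ (twistedGroupVN μ).toStarSubalgebra := by
  intro hfin
  have hli : LinearIndependent ℂ (fun g => twistedUnitary μ g) := by
    rw [linearIndependent_iff']
    intro s c hs g hg
    let ev : (twistedGroupVN μ).toStarSubalgebra →ₗ[ℂ] ℂ :=
      { toFun := fun x => twistedCoeff x g
        map_add' := fun _ _ => rfl
        map_smul' := fun _ _ => rfl }
    have h2 := congrArg ev hs
    rw [map_sum, map_zero, Finset.sum_eq_single g] at h2
    · rw [map_smul] at h2
      change c g * twistedCoeff (twistedUnitary μ g) g = 0 at h2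
      simpa [twistedCoeff_twistedUnitary h1 hμ] using h2
    · intro k _ hk
      rw [map_smul]
      change c k * twistedCoeff (twistedUnitary μ k) g = 0
      rw [twistedCoeff_twistedUnitary h1 hμ, lp.single_apply, Pi.single_eq_of_ne hk.symm, mul_zero]
    · exact fun h => absurd hg h
  exact (hli.finite).not_infinite ‹_›

/-- The Fourier coefficients of a central element transform by the cocycle under conjugation. -/
theorem twistedCoeff_central (hμ : IsScalarTwoCocycle μ) (h1 : ∀ g, μ 1 g = 1)
    {x : (twistedGroupVN μ).toStarSubalgebra} {g : G}
    (hx : x * twistedUnitary μ g = twistedUnitary μ g * x) (m : G) :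
    (μ (g * m * g⁻¹) g : ℂ) * twistedCoeff x (g * m * g⁻¹) = μ g m * twistedCoeff x m := by
  have h2 : twistedLeftRegular μ g (lp.single 2 1 (1 : ℂ)) = lp.single 2 g (1 : ℂ) := by
    rw [twistedLeftRegular_single, hμ.one_right h1, Circle.coe_one, one_smul, mul_one]
  have h3 : (x : lp (fun _ : G => ℂ) 2 →L[ℂ] lp (fun _ : G => ℂ) 2)
      (twistedLeftRegular μ g (lp.single 2 1 (1 : ℂ))) = twistedLeftRegular μ g
      ((x : lp (fun _ : G => ℂ) 2 →L[ℂ] lp (fun _ : G => ℂ) 2) (lp.single 2 1 (1 : ℂ))) :=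
    DFunLike.congr_fun (congrArg Subtype.val hx) _
  have h4 := congrArg (fun f : lp (fun _ : G => ℂ) 2 => f (g * m)) h3
  beta_reduce at h4
  rw [h2, apply_single_apply hμ h1, twistedLeftRegular_apply, inv_mul_cancel_left] at h4
  exact h4

/-- A central element has no Fourier coefficient at an element with infinite conjugacy class. -/
theorem twistedCoeff_central_eq_zero (hμ : IsScalarTwoCocycle μ) (h1 : ∀ g, μ 1 g = 1)
    {x : (twistedGroupVN μ).toStarSubalgebra}
    (hx : ∀ g, x * twistedUnitary μ g = twistedUnitary μ g * x) {m : G} (c : ℕ → G)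
    (hc : Function.Injective fun k => c k * m * (c k)⁻¹) : twistedCoeff x m = 0 := by
  -- The coefficients are square summable, yet of constant modulus along infinitely many conjugates.
  have hnorm : ∀ k, ‖twistedCoeff x (c k * m * (c k)⁻¹)‖ = ‖twistedCoeff x m‖ := fun k => by
    have := congrArg norm (twistedCoeff_central hμ h1 (hx (c k)) m)
    rwa [norm_mul, norm_mul, Circle.norm_coe, Circle.norm_coe, one_mul, one_mul] at this
  have hs := (memℓp_gen_iff (by norm_num : (0 : ℝ) < (2 : ENNReal).toReal)).1
    (lp.memℓp ((x : lp (fun _ : G => ℂ) 2 →L[ℂ] lp (fun _ : G => ℂ) 2) (lp.single 2 1 (1 : ℂ))))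
  have hs2 := hs.comp_injective hc
  have hs3 : Summable fun _ : ℕ => ‖twistedCoeff x m‖ ^ (2 : ENNReal).toReal :=
    hs2.congr fun k => by rw [← hnorm k]; rfl
  rw [summable_const_iff] at hs3
  simpa using hs3

end RightRegular

/-! ### Factoriality -/

section Factor

open Matrix

variable {n : ℕ} {Γ : Subgroup (GeneralLinearGroup (Fin n) ℤ)}

theorem symplecticForm_nondegenerate {x : Fin n ⊕ Fin n → ℤ} (hx : x ≠ 0) :
    ∃ y, symplecticForm y x ≠ 0 := by
  obtain ⟨i, hi⟩ := Function.ne_iff.1 hx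
  rcases i with i | i
  · refine ⟨Sum.elim 0 (Pi.single i 1), ?_⟩
    rw [← Sum.elim_comp_inl_inr x, symplecticForm_sumElim]
    simpa using hi
  · refine ⟨Sum.elim (Pi.single i 1) 0, ?_⟩
    rw [← Sum.elim_comp_inl_inr x, symplecticForm_sumElim]
    simpa using hi

theorem doubling_injective (n : ℕ) : Function.Injective (doubling n) := by
  intro g h hgh
  have h1 := congrArg Units.val hgh
  ext i j
  exact congrFun (congrFun (fromBlocks_inj.1 h1).1 i) j

theorem conj_inl_left (w : Fin n ⊕ Fin n → ℤ) (m : DoubledGroup Γ) :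
    ((SemidirectProduct.inl (Multiplicative.ofAdd w) * m *
      (SemidirectProduct.inl (Multiplicative.ofAdd w))⁻¹ : DoubledGroup Γ).left).toAdd =
    w + m.left.toAdd -
      (doubling n m.right : Matrix (Fin n ⊕ Fin n) (Fin n ⊕ Fin n) ℤ) *ᵥ w := by
  rw [← map_inv, SemidirectProduct.mul_left, SemidirectProduct.mul_left,
    SemidirectProduct.left_inl, SemidirectProduct.left_inl, SemidirectProduct.right_inl, map_one,
    SemidirectProduct.mul_right, SemidirectProduct.right_inl, one_mul]
  change w + m.left.toAdd +
      (doubling n m.right : Matrix (Fin n ⊕ Fin n) (Fin n ⊕ Fin n) ℤ) *ᵥ (-w) = _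
  rw [mulVec_neg, sub_eq_add_neg]

/-- Elements outside of `ℤ²ⁿ` have infinitely many conjugates. -/
theorem exists_injective_conj {m : DoubledGroup Γ} (hm : m.right ≠ 1) :
    ∃ c : ℕ → DoubledGroup Γ, Function.Injective fun k => c k * m * (c k)⁻¹ := by
  have h1 : (doubling n m.right : Matrix (Fin n ⊕ Fin n) (Fin n ⊕ Fin n) ℤ) ≠ 1 := by
    intro h
    apply hm
    have h2 : doubling n m.right = doubling n 1 := by
      rw [map_one]
      exact Units.ext h
    exact Subtype.ext (doubling_injective n h2)
  obtain ⟨w, hw⟩ : ∃ w, w - (doubling n m.right : Matrix (Fin n ⊕ Fin n) (Fin n ⊕ Fin n) ℤ) *ᵥ w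
      ≠ 0 := by
    by_contra! h
    apply h1
    refine Matrix.ext_of_mulVec_single fun i => ?_
    rw [one_mulVec]
    exact (sub_eq_zero.1 (h _)).symm
  obtain ⟨i, hi⟩ := Function.ne_iff.1 hw
  -- Conjugating by k w shifts the ℤ²ⁿ-component by k (w - θ w), whose coordinate `i` already
  -- separates the values of k.
  refine ⟨fun k => SemidirectProduct.inl (Multiplicative.ofAdd ((k : ℤ) • w)), fun k l hkl => ?_⟩
  have h2 := congrArg (fun g : DoubledGroup Γ => g.left.toAdd i) hkl
  beta_reduce at h2
  rw [conj_inl_left, conj_inl_left, mulVec_smul, mulVec_smul] at h2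
  simp only [Pi.add_apply, Pi.sub_apply, Pi.smul_apply, smul_eq_mul, Pi.zero_apply] at h2 hi
  have h3 : ((k : ℤ) - l) *
      (w i - ((doubling n m.right : Matrix (Fin n ⊕ Fin n) (Fin n ⊕ Fin n) ℤ) *ᵥ w) i) = 0 := by
    linear_combination h2
  have h4 := (mul_eq_zero.1 h3).resolve_right hi
  omega

theorem infinite_doubledGroup (hn : 1 ≤ n) : Infinite (DoubledGroup Γ) := by
  refine Infinite.of_injective (fun k : ℤ => (SemidirectProduct.inl (Multiplicative.ofAdd
    (Pi.single (Sum.inl ⟨0, hn⟩) k)) : DoubledGroup Γ)) fun k l hkl => ?_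
  exact Pi.single_injective _ (Multiplicative.ofAdd.injective
    (SemidirectProduct.inl_injective hkl))

theorem isII1Factor_doubledTwistedVN (hn : 1 ≤ n) {β : Circle} (hβ : ¬ IsOfFinOrder (β ^ 2)) :
    IsII1Factor (doubledTwistedVN Γ β) := by
  classical
  have := infinite_doubledGroup (Γ := Γ) hn
  have hμ := isScalarTwoCocycle_symplecticCocycle Γ β
  have h1 := symplecticCocycle_one_left (Γ := Γ) β
  refine ⟨fun x hx => ?_, not_finiteDimensional_twistedGroupVN hμ h1,
    _, isFaithfulNormalTrace_twistedTrace hμ h1⟩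
  change (twistedGroupVN (symplecticCocycle Γ β)).toStarSubalgebra at x
  replace hx : ∀ g, x * twistedUnitary (symplecticCocycle Γ β) g =
    twistedUnitary (symplecticCocycle Γ β) g * x := fun g => hx _
  have hzero : ∀ m : DoubledGroup Γ, m ≠ 1 → twistedCoeff x m = 0 := by
    intro m hm
    -- A nonzero v in ℤ²ⁿ may have a finite conjugacy class. Instead one takes w with ν(w, v) ≠ 0:
    -- conjugation by w fixes v, so a nonzero coefficient at v would give (β²)^ν(w, v) = 1.
    by_cases hr : m.right = 1
    · obtain ⟨v, rfl⟩ : ∃ v, m = SemidirectProduct.inl (Multiplicative.ofAdd v) :=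
        ⟨m.left.toAdd, SemidirectProduct.ext rfl hr⟩
      have hv : v ≠ 0 := by
        rintro rfl
        exact hm (map_one SemidirectProduct.inl)
      obtain ⟨w, hw⟩ := symplecticForm_nondegenerate hv
      have h2 := twistedCoeff_central hμ h1 (hx (SemidirectProduct.inl (Multiplicative.ofAdd w)))
        (SemidirectProduct.inl (Multiplicative.ofAdd v))
      have h3 : (SemidirectProduct.inl (Multiplicative.ofAdd w) *
          SemidirectProduct.inl (Multiplicative.ofAdd v) *
          (SemidirectProduct.inl (Multiplicative.ofAdd w))⁻¹ : DoubledGroup Γ) =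
          SemidirectProduct.inl (Multiplicative.ofAdd v) := by
        rw [← map_mul, mul_comm (Multiplicative.ofAdd w), map_mul, mul_inv_cancel_right]
      rw [h3, symplecticCocycle_inl, symplecticCocycle_inl] at h2
      by_contra hne
      have h4 := Circle.ext (mul_right_cancel₀ hne h2)
      apply hβ
      rw [isOfFinOrder_iff_zpow_eq_one]
      refine ⟨symplecticForm w v, hw, ?_⟩
      rw [symplecticForm_swap v w] at h4
      rw [sq, mul_zpow]
      nth_rw 1 [← h4]
      rw [← _root_.zpow_add, neg_add_cancel, zpow_zero]
    · obtain ⟨c, hc⟩ := exists_injective_conj hr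
      exact twistedCoeff_central_eq_zero hμ h1 hx c hc
  refine ⟨twistedCoeff x 1, ?_⟩
  refine ext_twistedCoeff (x := x)
    (y := twistedCoeff x 1 • (1 : (twistedGroupVN (symplecticCocycle Γ β)).toStarSubalgebra))
    hμ h1 fun g => ?_
  change _ = twistedCoeff x 1 * (lp.single 2 1 (1 : ℂ) : lp (fun _ : DoubledGroup Γ => ℂ) 2) g
  by_cases hg : g = 1
  · subst hg
    simp
  · rw [hzero g hg]
    simp [lp.single_apply, hg]

end Factor

/-! ### Separable L² spaces of traces and of their matrix amplifications -/

section GNS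

instance separableSpace_lp_two {ι : Type*} [Countable ι] {E : ι → Type*}
    [∀ i, NormedAddCommGroup (E i)] [∀ i, NormedSpace ℂ (E i)]
    [∀ i, TopologicalSpace.SeparableSpace (E i)] : TopologicalSpace.SeparableSpace (lp E 2) := by
  classical
  have h1 : TopologicalSpace.IsSeparable (⋃ i, Set.range fun a : E i => lp.single 2 i a) :=
    TopologicalSpace.IsSeparable.iUnion fun i =>
      TopologicalSpace.isSeparable_range (lp.isometry_single i).continuous
  rw [← TopologicalSpace.isSeparable_univ_iff]
  refine h1.span (R := ℂ) |>.closure.mono fun f _ => ?_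
  refine mem_closure_of_tendsto (lp.hasSum_single (by norm_num) f) (.of_forall fun s => ?_)
  exact Submodule.sum_mem _ fun i _ => Submodule.subset_span (Set.mem_iUnion.2 ⟨i, _, rfl⟩)

variable {H : Type u} [NormedAddCommGroup H] [InnerProductSpace ℂ H]

theorem memℓp_apply {ξ : ℕ → H} (hξ : Summable fun i => ‖ξ i‖ ^ 2) (T : H →L[ℂ] H) :
    Memℓp (fun i => T (ξ i)) 2 := by
  rw [memℓp_gen_iff (by norm_num)]
  refine Summable.of_nonneg_of_le (fun i => by positivity) (fun i => ?_) (hξ.mul_left (‖T‖ ^ 2))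
  rw [← mul_pow]
  simpa using pow_le_pow_left₀ (norm_nonneg _) (T.le_opNorm (ξ i)) 2

variable [CompleteSpace H]

/-- The map `x ↦ (x ξ_i)_i` into the direct sum of copies of `H`. -/
noncomputable def vectorMap (M : VonNeumannAlgebra H) {ξ : ℕ → H}
    (hξ : Summable fun i => ‖ξ i‖ ^ 2) : M.toStarSubalgebra →ₗ[ℂ] lp (fun _ : ℕ => H) 2 where
  toFun x := ⟨fun i => (x : H →L[ℂ] H) (ξ i), memℓp_apply hξ x⟩
  map_add' _ _ := rfl
  map_smul' _ _ := rfl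

/-- Normality realises the GNS space concretely: x ↦ (x ξ_i)_i has inner products τ(x⋆ y). The
target ℓ²(ℕ, H) is separable as soon as `H` is. -/
theorem IsFaithfulNormalTrace.exists_isTracialMap {M : VonNeumannAlgebra H}
    {τ : M.toStarSubalgebra →ₗ[ℂ] ℂ} (hτ : IsFaithfulNormalTrace M τ) :
    ∃ J : M.toStarSubalgebra →ₗ[ℂ] lp (fun _ : ℕ => H) 2, IsTracialMap J := by
  obtain ⟨ξ, hξ, hsum⟩ := hτ.normal
  have hinner : ∀ x y, inner ℂ (vectorMap M hξ x) (vectorMap M hξ y) = τ (star x * y) := by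
    intro x y
    rw [lp.inner_eq_tsum, ← (hsum (star x * y)).tsum_eq]
    refine tsum_congr fun i => ?_
    change inner ℂ ((x : H →L[ℂ] H) (ξ i)) ((y : H →L[ℂ] H) (ξ i)) =
      inner ℂ (ξ i) (ContinuousLinearMap.adjoint (x : H →L[ℂ] H) ((y : H →L[ℂ] H) (ξ i)))
    rw [ContinuousLinearMap.adjoint_inner_right]
  refine ⟨vectorMap M hξ, fun a x y => ?_, fun x y => ?_, ?_⟩
  · rw [hinner, hinner, star_mul, mul_assoc]
  · rw [hinner, hinner, star_star, hτ.tracial]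
  · rw [injective_iff_map_eq_zero]
    intro x hx
    exact hτ.faithful x (by rw [← hinner, hx, inner_zero_left])

variable {A : Type*} [Ring A] [StarRing A] [Algebra ℂ A] {V : Type v} [NormedAddCommGroup V]
  [InnerProductSpace ℂ V]

/-- The entrywise amplification of `J` to matrices. -/
noncomputable def matrixVectorMap (k : ℕ) (J : A →ₗ[ℂ] V) :
    Matrix (Fin k) (Fin k) A →ₗ[ℂ] PiLp 2 (fun _ : Fin k × Fin k => V) where
  toFun x := WithLp.toLp 2 fun ij => J (x ij.1 ij.2)
  map_add' x y := by
    ext ij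
    simp
  map_smul' c x := by
    ext ij
    simp

/-- The sum of entrywise inner products is the one of the trace Tr ⊗ τ. -/
theorem IsTracialMap.matrix {J : A →ₗ[ℂ] V} (hJ : IsTracialMap J) (k : ℕ) :
    IsTracialMap (matrixVectorMap k J) where
  inner_mul_left a x y := by
    simp only [PiLp.inner_apply, matrixVectorMap, LinearMap.coe_mk, AddHom.coe_mk,
      Fintype.sum_prod_type, Matrix.mul_apply, map_sum, sum_inner, inner_sum, hJ.inner_mul_left,
      Matrix.star_apply]
    rw [Finset.sum_comm]
    conv_rhs => rw [Finset.sum_comm]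
    exact Finset.sum_congr rfl fun j _ => Finset.sum_comm
  inner_star x y := by
    simp only [PiLp.inner_apply, matrixVectorMap, LinearMap.coe_mk, AddHom.coe_mk,
      Fintype.sum_prod_type, Matrix.star_apply, hJ.inner_star]
    exact Finset.sum_comm
  injective x y hxy := by
    ext i j
    exact hJ.injective (congrFun (congrArg WithLp.ofLp hxy) (i, j))

end GNS

/-! ### Uncountability of the parameters and conclusion -/

theorem not_countable_setOf_not_isOfFinOrder : ¬ {α : Circle | ¬ IsOfFinOrder α}.Countable := by
  intro h
  have h1 : {α : Circle | IsOfFinOrder α}.Countable := by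
    have h2 : {α : Circle | IsOfFinOrder α} ⊆
        ⋃ k : ℕ, {α : Circle | α ^ (k + 1) = 1} := fun α hα => by
      obtain ⟨k, hk, hk'⟩ := isOfFinOrder_iff_pow_eq_one.1 hα
      exact Set.mem_iUnion.2 ⟨k - 1, by rwa [Set.mem_ofPred_eq, Nat.sub_add_cancel hk]⟩
    refine (Set.countable_iUnion fun k => ?_).mono h2
    refine Set.Finite.countable (Set.Finite.of_finite_image (f := fun z : Circle => (z : ℂ)) ?_
      Circle.coe_injective.injOn)
    refine (Polynomial.nthRootsFinset (k + 1) (1 : ℂ)).finite_toSet.subset ?_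
    rintro _ ⟨z, hz, rfl⟩
    rw [Finset.mem_coe, Polynomial.mem_nthRootsFinset k.succ_pos]
    rw [← Circle.coe_pow, show z ^ (k + 1) = 1 from hz, Circle.coe_one]
  have h3 : (Set.univ : Set Circle).Countable :=
    (h1.union h).mono fun α _ => em (IsOfFinOrder α)
  rw [Set.countable_univ_iff, Circle.argEquiv.countable_iff, Set.countable_coe_iff] at h3
  have h4 := Cardinal.mk_Ioc_real (show -Real.pi < Real.pi by linarith [Real.pi_pos])
  have h5 := h3.le_aleph0
  rw [h4] at h5
  exact absurd h5 Cardinal.aleph0_lt_continuum.not_ge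

theorem countable_doubledGroup {n : ℕ} (Γ : Subgroup (Matrix.GeneralLinearGroup (Fin n) ℤ)) :
    Countable (DoubledGroup Γ) := by
  have h1 : Countable (Matrix (Fin n) (Fin n) ℤ) :=
    inferInstanceAs (Countable (Fin n → Fin n → ℤ))
  have h2 : Countable (Matrix.GeneralLinearGroup (Fin n) ℤ) := Units.val_injective.countable
  have h3 : Countable (Multiplicative (Fin n ⊕ Fin n → ℤ)) :=
    inferInstanceAs (Countable (Fin n ⊕ Fin n → ℤ))
  exact SemidirectProduct.equivProd.injective.countable

theorem corollary2p4 (n : ℕ) (hn : 1 ≤ n) (Γ : Subgroup (Matrix.GeneralLinearGroup (Fin n) ℤ))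
    (hT : HasRelativePropertyT (latticeSubgroup Γ.subtype))
    -- a choice `α ↦ α^{1/2}` of square roots
    (r : Circle → Circle) (hr : ∀ α, r α ^ 2 = α) :
    -- the algebras `M_α` with `α` not a root of unity are `II₁` factors
    (∀ α : Circle, ¬ IsOfFinOrder α → IsII1Factor (doubledTwistedVN Γ (r α))) ∧
    -- not all of these factors embed into one separable `II₁` factor
    (∀ (H : Type u) [NormedAddCommGroup H] [InnerProductSpace ℂ H] [CompleteSpace H]
      [TopologicalSpace.SeparableSpace H] (M : VonNeumannAlgebra H), IsII1Factor M →
      ¬ ∀ α : Circle, ¬ IsOfFinOrder α → EmbedsInto (doubledTwistedVN Γ (r α)) M) ∧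
    -- only countably many `M_α` are stably isomorphic to a given one
    (∀ α₀ : Circle, {α : Circle |
      StablyIsomorphic (doubledTwistedVN Γ (r α)) (doubledTwistedVN Γ (r α₀))}.Countable) := by
  classical
  refine ⟨fun α hα => isII1Factor_doubledTwistedVN hn (by rwa [hr]), ?_, fun α₀ => ?_⟩
  · intro H _ _ _ _ M hM hemb
    obtain ⟨τ, hτ⟩ := hM.exists_trace
    obtain ⟨J, hJ⟩ := hτ.exists_isTracialMap
    exact not_countable_setOf_not_isOfFinOrder
      ((countable_setOf_embeds hn hT r hr hJ).mono fun α hα => hemb α hα)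
  · have := countable_doubledGroup Γ
    obtain ⟨J, hJ⟩ := (isFaithfulNormalTrace_twistedTrace
      (isScalarTwoCocycle_symplecticCocycle Γ (r α₀))
      (symplecticCocycle_one_left (r α₀))).exists_isTracialMap
    -- Of a stable isomorphism only the injection into M_k(M_{α₀}) is needed. The L² space is
    -- separable because the group is countable.
    refine (Set.countable_iUnion fun k : ℕ =>
      countable_setOf_embeds hn hT r hr (hJ.matrix k)).mono ?_
    rintro α ⟨k, p, -, φ, hφ, -⟩
    exact Set.mem_iUnion.2 ⟨k, φ, hφ⟩
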